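/- Let $\mathbf{Mnd}_f(\mathbf{Set})$ be the category of finitary monads on $\mathbf{Set}$ (monads whose underlying endofunctor preserves filtered colimits) and monad morphisms, and let $\mathbf{Alg}\colon \mathbf{Mnd}_f(\mathbf{Set})^{\mathrm{op}}\to\mathbf{CAT}$ send a monad to its category of Eilenberg–Moore algebras and a monad morphism to restriction along it. A *Lawvere theory* is a category $\mathcal T$ with finite products whose objects are the distinct finite powers $X^n$ ($n\in\mathbb N$) of a distinguished object $X=X^1$, the product projections $\pi_i\colon X^n\to X$ being chosen (with $\pi_1\colon X^1\to X$ the identity). A morphism of Lawvere theories is a functor strictly preserving the distinguished object and its finite powers, including the projections. These form a category $\mathbf{Law}$. A *model* of $\mathcal T$ is a finite-product-preserving functor $\mathcal T\to\mathbf{Set}$; models and natural transformations form a category $\mathbf{Mod}(\mathcal T)$, and precomposition gives a functor $\mathbf{Mod}\colon\mathbf{Law}^{\mathrm{op}}\to\mathbf{CAT}$. Let $\mathcal F$ be the category of finite cardinals and give $[\mathcal F,\mathbf{Set}]$ the monoidal structure that corresponds to composition of finitary endofunctors of $\mathbf{Set}$. An $[\mathcal F,\mathbf{Set}]$-category $\mathcal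 M$ thus has hom-sets $\mathcal M_n(X,Y)$, functorial in $n\in\mathcal F$, identities in $\mathcal M_1(X,X)$, and compositions $\mathcal M_m(Y,Z)\times\mathcal M_n(X,Y)^m\to\mathcal M_n(X,Z)$. For a monad $T$ on $\mathbf{Set}$ let $\Sigma T$ be the one-object $[\mathcal F,\mathbf{Set}]$-category with $(\Sigma T)_n=T(n)$ and with identity and composition given by the unit and multiplication of $T$. For an $[\mathcal F,\mathbf{Set}]$-category $\mathcal M$ let $L\mathcal M$ be its representable completion: its objects are the formal tensors $X^{(n)}$ of objects $X$ of $\mathcal M$ by the representables $\mathcal F(n,-)$, $n\in\mathbb N$, its homs are $(L\mathcal M)_k(X^{(n)},Y^{(m)})=\mathcal M_{nk}(X,Y)^m$, its identities are tuples of projections, and its composition is induced by that of $\mathcal M$. The underlying ordinary category of $L(\Sigma T)$ (with homs the $L(\Sigma T)_1$), with distinguished object $X^{(1)}$ for $X$ the unique object of $\Sigma T$, is a Lawvere theory, functorially in $T$. **Proposition.** There is an equivalence of categories $E\colon\mathbf{Mnd}_f(\mathbf{Set})\simeq\mathbf{Law}$ that is naturally isomorphic to $T\mapsto L(\Sigma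 T)$, and there is a pseudonatural equivalence $$\mathbf{Alg}\;\simeq\;\mathbf{Mod}\circ E^{\mathrm{op}}\colon\ \mathbf{Mnd}_f(\mathbf{Set})^{\mathrm{op}}\to\mathbf{CAT},$$ that is, a pseudonatural transformation whose components $\mathbf{Alg}(T)\to\mathbf{Mod}(E(T))$ are equivalences of categories. -/

import Mathlib

open CategoryTheory CategoryTheory.Limits

universe u v

namespace MonadTheory

/-! ### Finitary monads on the category of sets -/

/-- A monad on `Type u` is finitary if its underlying endofunctor preserves filtered colimits. -/
def isFinitary : ObjectProperty (Monad (Type u)) :=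
  fun T => PreservesFilteredColimits (T : Type u ⥤ Type u)

/-- The category `Mnd_f(Set)` of finitary monads on `Type u` and all monad morphisms. -/
abbrev FinitaryMonad : Type (u + 1) := (isFinitary.{u}).FullSubcategory

theorem algebra_eqToHom_f {T : Monad (Type u)} {A B : T.Algebra} (h : A = B) :
    (eqToHom h).f = eqToHom (congrArg Monad.Algebra.A h) := by
  subst h
  rfl

theorem algebraFunctor_id (T : Monad (Type u)) :
    Monad.algebraFunctorOfMonadHom (𝟙 T) = 𝟭 T.Algebra := by
  refine CategoryTheory.Functor.ext (h_obj := fun A => ?_) (h_map := fun A B f => ?_)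
  · change Monad.Algebra.mk A.A (𝟙 _ ≫ A.a) _ _ = Monad.Algebra.mk A.A A.a _ _
    congr 1
  · apply Monad.Algebra.Hom.ext
    rw [Monad.Algebra.comp_f, Monad.Algebra.comp_f, algebra_eqToHom_f, algebra_eqToHom_f]
    rfl

theorem algebraFunctor_comp {R S T : Monad (Type u)} (f : R ⟶ S) (g : S ⟶ T) :
    Monad.algebraFunctorOfMonadHom (f ≫ g) =
      Monad.algebraFunctorOfMonadHom g ⋙ Monad.algebraFunctorOfMonadHom f := by
  have h (A : T.Algebra) : (Monad.algebraFunctorOfMonadHom (f ≫ g)).obj A =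
      (Monad.algebraFunctorOfMonadHom g ⋙ Monad.algebraFunctorOfMonadHom f).obj A := rfl
  refine CategoryTheory.Functor.ext (h_obj := h) (h_map := fun A B k => ?_)
  · apply Monad.Algebra.Hom.ext
    rw [Monad.Algebra.comp_f, Monad.Algebra.comp_f, algebra_eqToHom_f, algebra_eqToHom_f]
    rfl

/-- The functor `Alg`, sending a finitary monad to its category of Eilenberg–Moore algebras and a
monad morphism `S ⟶ T` to the functor `Alg T ⥤ Alg S` that restricts the action along it. -/
def algebras : FinitaryMonad.{u}ᵒᵖ ⥤ Cat.{u, u + 1} where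
  obj T := Cat.of T.unop.obj.Algebra
  map f := (Monad.algebraFunctorOfMonadHom f.unop.hom).toCatHom
  map_id T := congrArg Functor.toCatHom (algebraFunctor_id T.unop.obj)
  map_comp f g := congrArg Functor.toCatHom (algebraFunctor_comp g.unop.hom f.unop.hom)

/-! ### Finite products of finite powers -/

section Products

variable {C : Type*} [Category C]

theorem fan_isLimit_iff {J : Type*} {f : J → C} (P : C) (p : ∀ j, P ⟶ f j) :
    Nonempty (IsLimit (Fan.mk P p)) ↔
      ∀ Z : C, Function.Bijective (fun (g : Z ⟶ P) (j : J) => g ≫ p j) := by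
  constructor
  · rintro ⟨h⟩ Z
    refine ⟨fun g g' e => Fan.IsLimit.hom_ext h _ _ fun j => congrFun e j, fun k => ?_⟩
    exact ⟨Fan.IsLimit.lift h k, funext fun j => Fan.IsLimit.fac h k j⟩
  · intro h
    refine ⟨Fan.IsLimit.mk _ (fun s => ((h s.pt).2 s.proj).choose) (fun s j => ?_)
      (fun s m hm => (h s.pt).1 ?_)⟩
    · exact congrFun ((h s.pt).2 s.proj).choose_spec j
    · refine Eq.trans (funext hm) ((h s.pt).2 s.proj).choose_spec.symm

theorem fan_sigma_isLimit_iff {J : Type*} {K : J → Type*} {X P : C} {f : J → C}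
    (p : ∀ j, P ⟶ f j) (q : ∀ j, K j → (f j ⟶ X))
    (hq : ∀ j, Nonempty (IsLimit (Fan.mk (f j) (q j)))) :
    Nonempty (IsLimit (Fan.mk P (fun a : Σ j, K j => p a.1 ≫ q a.1 a.2))) ↔
      Nonempty (IsLimit (Fan.mk P p)) := by
  simp only [fan_isLimit_iff] at hq ⊢
  refine forall_congr' fun Z => ?_
  let e : (∀ j, Z ⟶ f j) ≃ ((Σ j, K j) → (Z ⟶ X)) :=
    (Equiv.piCongrRight fun j => Equiv.ofBijective _ (hq j Z)).trans
      (Equiv.piCurry (fun (j : J) (_ : K j) => (Z ⟶ X))).symm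
  have : (fun (g : Z ⟶ P) (a : Σ j, K j) => g ≫ p a.1 ≫ q a.1 a.2) =
      e ∘ fun (g : Z ⟶ P) (j : J) => g ≫ p j := by
    funext g a
    simp [e, Equiv.piCurry, Sigma.uncurry]
  rw [this]
  exact e.bijective.of_comp_iff' _

theorem fan_reindex_isLimit_iff {J K : Type*} {X P : C} (e : K ≃ J) (p : J → (P ⟶ X)) :
    Nonempty (IsLimit (Fan.mk P (fun k => p (e k)))) ↔ Nonempty (IsLimit (Fan.mk P p)) := by
  simp only [fan_isLimit_iff]
  refine forall_congr' fun Z => ?_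
  exact (Equiv.arrowCongr e.symm (Equiv.refl (Z ⟶ X))).bijective.of_comp_iff'
    (fun (g : Z ⟶ P) (j : J) => g ≫ p j)

theorem fan_isLimit_of_iso {J : Type*} {f : J → C} {P Q : C} (u : P ≅ Q) (p : ∀ j, P ⟶ f j)
    (q : ∀ j, Q ⟶ f j) (hu : ∀ j, u.hom ≫ q j = p j)
    (h : Nonempty (IsLimit (Fan.mk Q q))) : Nonempty (IsLimit (Fan.mk P p)) :=
  h.map fun h => h.ofIsoLimit (Fan.ext u.symm fun j => by simp [← hu])

variable {X : C} {P : ℕ → C} (π : ∀ n, Fin n → (P n ⟶ X))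

/-- A category in which every object is a chosen finite power of one object has finite products. -/
theorem hasFiniteProducts_of_powers (hP : Function.Surjective P)
    (hπ : ∀ n, Nonempty (IsLimit (Fan.mk (P n) (π n)))) : HasFiniteProducts C := by
  refine ⟨fun k => ⟨fun D => ?_⟩⟩
  suffices h : HasLimit (Discrete.functor (fun j => D.obj ⟨j⟩)) from
    hasLimit_of_iso (F := Discrete.functor (fun j => D.obj ⟨j⟩))
      (Discrete.natIso fun _ => Iso.refl _)
  choose n hn using fun j => hP (D.obj ⟨j⟩)
  have hq : ∀ j, Nonempty (IsLimit (Fan.mk (D.obj ⟨j⟩)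
      (fun i => eqToHom (hn j).symm ≫ π (n j) i))) := fun j =>
    fan_isLimit_of_iso (eqToIso (hn j).symm) _ _ (fun _ => rfl) (hπ (n j))
  let e := Fintype.equivFin (Σ j, Fin (n j))
  have hK := (fan_reindex_isLimit_iff e _).2 (hπ (Fintype.card (Σ j, Fin (n j))))
  choose l hl using fun j => ((fan_isLimit_iff _ _).1 (hq j) _).2 (fun i => π _ (e ⟨j, i⟩))
  obtain ⟨h⟩ := (fan_sigma_isLimit_iff l _ hq).1 (by
    convert hK using 5 with a
    exact congrFun (hl a.1) a.2)
  exact ⟨⟨⟨_, h⟩⟩⟩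

/-- If every object of `C` is a chosen finite power of one object, then a functor out of `C` that
preserves these powers preserves all finite products. -/
theorem preservesFiniteProducts_of_powers {D : Type*} [Category D] (F : C ⥤ D)
    (hP : Function.Surjective P) (hπ : ∀ n, Nonempty (IsLimit (Fan.mk (P n) (π n))))
    (hF : ∀ n, Nonempty (IsLimit (Fan.mk (F.obj (P n)) (fun i => F.map (π n i))))) :
    PreservesFiniteProducts F := by
  -- any finite power cone of `X` is preserved
  have key : ∀ {K : Type} [Fintype K] {Q : C} (p : K → (Q ⟶ X)),
      Nonempty (IsLimit (Fan.mk Q p)) →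
      Nonempty (IsLimit (Fan.mk (F.obj Q) (fun k => F.map (p k)))) := by
    intro K _ Q p hp
    let e := Fintype.equivFin K
    obtain ⟨h₁⟩ := hp
    obtain ⟨h₂⟩ := (fan_reindex_isLimit_iff e _).2 (hπ (Fintype.card K))
    refine fan_isLimit_of_iso (F.mapIso (h₁.conePointUniqueUpToIso h₂)) _ _ (fun k => ?_)
      ((fan_reindex_isLimit_iff e _).2 (hF (Fintype.card K)))
    have := h₁.conePointUniqueUpToIso_hom_comp h₂ ⟨k⟩
    dsimp at this ⊢
    rw [← F.map_comp]
    exact congrArg _ this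
  refine ⟨fun k => ⟨fun {E} => ?_⟩⟩
  suffices h : PreservesLimit (Discrete.functor (fun j => E.obj ⟨j⟩)) F from
    preservesLimit_of_iso_diagram F (K₁ := Discrete.functor (fun j => E.obj ⟨j⟩))
      (Discrete.natIso fun _ => Iso.refl _)
  refine ⟨fun {c} hc => ?_⟩
  choose n hn using fun j => hP (E.obj ⟨j⟩)
  have hq : ∀ j, Nonempty (IsLimit (Fan.mk (E.obj ⟨j⟩)
      (fun i => eqToHom (hn j).symm ≫ π (n j) i))) := fun j =>
    fan_isLimit_of_iso (eqToIso (hn j).symm) _ _ (fun _ => rfl) (hπ (n j))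
  let c' : Fan (fun j => E.obj ⟨j⟩) := c
  have hc' : Nonempty (IsLimit (Fan.mk c'.pt c'.proj)) :=
    ⟨hc.ofIsoLimit (Fan.ext (Iso.refl _) (fun j => by
      simp only [Iso.refl_hom, Category.id_comp]; rfl))⟩
  have h₁ := key _ ((fan_sigma_isLimit_iff c'.proj _ hq).2 hc')
  have h₂ := fan_sigma_isLimit_iff (fun j => F.map (c'.proj j))
    (fun j i => F.map (eqToHom (hn j).symm ≫ π (n j) i)) (fun j => key _ (hq j))
  obtain ⟨h₃⟩ := h₂.1 (by simpa only [Functor.map_comp] using h₁)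
  exact ⟨(Fan.isLimitMapConeEquiv F _ c').symm h₃⟩

end Products

/-! ### Lawvere theories and their models -/

/-- A Lawvere theory: a (small) category whose objects are the distinct finite powers
`X ^ n = pow n` of a distinguished object `X = pow 1`, with the product projections
`π n i : X ^ n ⟶ X` chosen (and `X ^ 1 = X` being the trivial power). Such a category has finite
products, see `LawvereTheory.hasFiniteProducts`. -/
structure LawvereTheory where
  /-- The objects. -/
  Obj : Type u
  /-- The category structure. -/
  [category : Category.{u} Obj]
  /-- The finite powers of the distinguished object `pow 1`. -/
  pow : ℕ → Obj
  /-- The objects are the distinct powers. -/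
  pow_bijective : Function.Bijective pow
  /-- The product projections. -/
  π (n : ℕ) (i : Fin n) : pow n ⟶ pow 1
  /-- `pow n` is the `n`-fold power of the distinguished object. -/
  isPower (n : ℕ) : Nonempty (IsLimit (Fan.mk (pow n) (π n)))
  π_one : π 1 0 = 𝟙 (pow 1)

namespace LawvereTheory

attribute [instance] LawvereTheory.category

instance hasFiniteProducts (L : LawvereTheory.{u}) : HasFiniteProducts L.Obj :=
  hasFiniteProducts_of_powers L.π L.pow_bijective.2 L.isPower

/-- A morphism of Lawvere theories: a functor that strictly preserves the distinguished object and
its finite powers, projections included. -/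
@[ext]
structure Hom (L L' : LawvereTheory.{u}) where
  /-- The underlying functor. -/
  toFunctor : L.Obj ⥤ L'.Obj
  obj_pow (n : ℕ) : toFunctor.obj (L.pow n) = L'.pow n
  map_π (n : ℕ) (i : Fin n) : toFunctor.map (L.π n i) =
    eqToHom (obj_pow n) ≫ L'.π n i ≫ eqToHom (obj_pow 1).symm

/-- The category `Law` of Lawvere theories. -/
instance : Category LawvereTheory.{u} where
  Hom := Hom
  id L := ⟨𝟭 _, fun _ => rfl, by simp⟩
  comp F G := ⟨F.toFunctor ⋙ G.toFunctor, by simp [Hom.obj_pow], by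
    intro n i
    simp [Hom.map_π, eqToHom_map]⟩

/-- Morphisms of Lawvere theories preserve all finite products. -/
theorem Hom.preservesFiniteProducts {L L' : LawvereTheory.{u}} (F : L ⟶ L') :
    PreservesFiniteProducts (Hom.toFunctor F) := by
  refine preservesFiniteProducts_of_powers L.π _ L.pow_bijective.2 L.isPower fun n => ?_
  have h := (fan_isLimit_iff _ _).1 (L'.isPower n)
  refine (fan_isLimit_iff _ _).2 fun Z => ?_
  let e₁ : (Z ⟶ (Hom.toFunctor F).obj (L.pow n)) ≃ (Z ⟶ L'.pow n) :=
    (Iso.refl Z).homCongr (eqToIso (Hom.obj_pow F n))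
  let e₂ : (Fin n → (Z ⟶ L'.pow 1)) ≃ (Fin n → (Z ⟶ (Hom.toFunctor F).obj (L.pow 1))) :=
    Equiv.piCongrRight fun _ => (Iso.refl Z).homCongr (eqToIso (Hom.obj_pow F 1).symm)
  convert e₂.bijective.comp ((h Z).comp e₁.bijective) using 1
  funext g i
  simp [e₁, e₂, Hom.map_π]

/-- A functor from a Lawvere theory to sets is a model if it preserves finite products. -/
def isModel (L : LawvereTheory.{u}) : ObjectProperty (L.Obj ⥤ Type u) :=
  fun F => PreservesFiniteProducts F

/-- The category of models of a Lawvere theory, with all natural transformations as morphisms. -/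
abbrev Model (L : LawvereTheory.{u}) : Type (u + 1) := L.isModel.FullSubcategory

/-- Restriction of models along a morphism of Lawvere theories. -/
def Model.restrict {L L' : LawvereTheory.{u}} (F : L ⟶ L') : L'.Model ⥤ L.Model where
  obj M := ⟨Hom.toFunctor F ⋙ M.obj, by
    have := Hom.preservesFiniteProducts F
    have : PreservesFiniteProducts M.obj := M.property
    exact comp_preservesFiniteProducts _ _⟩
  map α := ⟨Functor.whiskerLeft (Hom.toFunctor F) α.hom⟩

/-- The functor `Mod`, sending a Lawvere theory to its category of models and a morphism of
theories `L ⟶ L'` to the restriction functor `Mod L' ⥤ Mod L`. -/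
def models : LawvereTheory.{u}ᵒᵖ ⥤ Cat.{u, u + 1} where
  obj L := Cat.of L.unop.Model
  map F := (Model.restrict F.unop).toCatHom
  map_id _ := rfl
  map_comp _ _ := rfl

end LawvereTheory

/-! ### Categories enriched in `[𝓕, Set]` -/

set_option linter.checkUnivs false in
/-- An `[𝓕, Set]`-category, where `𝓕` is the category of finite cardinals and `[𝓕, Set]` carries
the substitution (composition) monoidal structure, written out explicitly. -/
structure FSetCat where
  /-- The objects. -/
  Obj : Type v
  /-- The value at the cardinal `n` of the hom-object from `X` to `Y`. -/
  Hom (X Y : Obj) (n : ℕ) : Type u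
  /-- The functoriality of the hom-objects. -/
  reindex {X Y : Obj} {n m : ℕ} (φ : Fin n → Fin m) : Hom X Y n → Hom X Y m
  /-- The identities. -/
  one (X : Obj) : Hom X X 1
  /-- The composite `g ∘ (f₁, …, fₘ)`. -/
  comp {X Y Z : Obj} {m n : ℕ} (g : Hom Y Z m) (f : Fin m → Hom X Y n) : Hom X Z n
  reindex_id {X Y : Obj} {n : ℕ} (f : Hom X Y n) : reindex id f = f
  reindex_reindex {X Y : Obj} {n m k : ℕ} (φ : Fin n → Fin m) (ψ : Fin m → Fin k)
    (f : Hom X Y n) : reindex ψ (reindex φ f) = reindex (ψ ∘ φ) f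
  reindex_comp {X Y Z : Obj} {m n k : ℕ} (φ : Fin n → Fin k) (g : Hom Y Z m)
    (f : Fin m → Hom X Y n) : reindex φ (comp g f) = comp g (fun i => reindex φ (f i))
  comp_reindex {X Y Z : Obj} {m n k : ℕ} (φ : Fin m → Fin k) (g : Hom Y Z m)
    (f : Fin k → Hom X Y n) : comp (reindex φ g) f = comp g (fun i => f (φ i))
  proj_comp {X Y : Obj} {m n : ℕ} (i : Fin m) (f : Fin m → Hom X Y n) :
    comp (reindex (fun _ => i) (one Y)) f = f i
  comp_proj {X Y : Obj} {m : ℕ} (g : Hom X Y m) :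
    comp g (fun i => reindex (fun _ => i) (one X)) = g
  assoc {W X Y Z : Obj} {j k n : ℕ} (h : Hom Y Z j) (g : Fin j → Hom X Y k)
    (f : Fin k → Hom W X n) : comp h (fun i => comp (g i) f) = comp (comp h g) f

/-- An `[𝓕, Set]`-functor. -/
structure FSetFunctor (M N : FSetCat.{u, v}) where
  /-- The action on objects. -/
  obj : M.Obj → N.Obj
  /-- The action on hom-objects. -/
  map {X Y : M.Obj} {n : ℕ} : M.Hom X Y n → N.Hom (obj X) (obj Y) n
  map_reindex {X Y : M.Obj} {n m : ℕ} (φ : Fin n → Fin m) (f : M.Hom X Y n) :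
    map (M.reindex φ f) = N.reindex φ (map f)
  map_one (X : M.Obj) : map (M.one X) = N.one (obj X)
  map_comp {X Y Z : M.Obj} {m n : ℕ} (g : M.Hom Y Z m) (f : Fin m → M.Hom X Y n) :
    map (M.comp g f) = N.comp (map g) (fun i => map (f i))

namespace FSetCat

variable (M : FSetCat.{u, v})

/-- The `i`-th projection `πᵢ`, of arity `n`. -/
def proj (X : M.Obj) {n : ℕ} (i : Fin n) : M.Hom X X n := M.reindex (fun _ => i) (M.one X)

/-- The objects of the underlying ordinary category. -/
structure Underlying where
  /-- The object itself. -/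
  obj : M.Obj

/-- The underlying ordinary category of an `[𝓕, Set]`-category, with morphisms the unary ones. -/
instance : Category.{u} M.Underlying where
  Hom X Y := M.Hom X.obj Y.obj 1
  id X := M.one X.obj
  comp f g := M.comp g (fun _ => f)
  id_comp {X Y} f := by
    have h := M.comp_proj f
    have e : ∀ i : Fin 1, M.reindex (fun _ => i) (M.one X.obj) = M.one X.obj := fun i => by
      rw [show (fun _ : Fin 1 => i) = id from funext fun j => Subsingleton.elim _ _, M.reindex_id]
    simpa only [e] using h
  comp_id {X Y} f := by
    have h := M.proj_comp (0 : Fin 1) (fun _ => f)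
    rwa [show (fun _ : Fin 1 => (0 : Fin 1)) = id from
      funext fun j => Subsingleton.elim _ _, M.reindex_id] at h
  assoc f g h := M.assoc h (fun _ => g) (fun _ => f)

/-- The functor between underlying ordinary categories. -/
def _root_.MonadTheory.FSetFunctor.underlying {M N : FSetCat.{u, v}} (F : FSetFunctor M N) :
    M.Underlying ⥤ N.Underlying where
  obj X := ⟨F.obj X.obj⟩
  map f := F.map f
  map_id X := F.map_one X.obj
  map_comp f g := F.map_comp g (fun _ => f)

/-- The object `X ^ (n)` of the representable completion: the formal tensor of `X` by the
representable `yₙ = 𝓕(n, -)`. -/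
structure FormalTensor where
  /-- The object being tensored. -/
  base : M.Obj
  /-- The exponent `n`. -/
  exp : ℕ

/-- The action of a map `φ` on the second coordinate, `a × n → a × m`. -/
def timesMap (a : ℕ) {n m : ℕ} (φ : Fin n → Fin m) (s : Fin (a * n)) : Fin (a * m) :=
  finProdFinEquiv ((finProdFinEquiv.symm s).1, φ (finProdFinEquiv.symm s).2)

/-- The representable completion `L M` of an `[𝓕, Set]`-category: its objects are the formal tensors
`X ^ (n)` and its homs are `(L M)ₖ(X ^ (n), Y ^ (m)) = Mₙₖ(X, Y) ^ m`. -/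
def completion : FSetCat.{u, v} where
  Obj := M.FormalTensor
  Hom X Y k := Fin Y.exp → M.Hom X.base Y.base (X.exp * k)
  reindex {X _ _ _} φ f := fun i => M.reindex (timesMap X.exp φ) (f i)
  one X := fun i => M.proj X.base (finProdFinEquiv (i, 0))
  comp g f := fun i =>
    M.comp (g i) (fun s => f (finProdFinEquiv.symm s).2 (finProdFinEquiv.symm s).1)
  reindex_id f := by
    funext i
    rw [show ∀ a n : ℕ, timesMap a (id : Fin n → Fin n) = id from fun a n => by
      funext s; simp only [timesMap, id, Prod.mk.eta, Equiv.apply_symm_apply], M.reindex_id]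
  reindex_reindex φ ψ f := by
    funext i
    rw [M.reindex_reindex]
    congr 1
    funext s
    simp only [timesMap, Function.comp, Equiv.symm_apply_apply]
  reindex_comp φ g f := by
    funext i
    rw [M.reindex_comp]
  comp_reindex φ g f := by
    funext i
    rw [M.comp_reindex]
    simp only [timesMap, Equiv.symm_apply_apply]
  proj_comp i f := by
    funext j
    simp only [proj, M.reindex_reindex, Function.comp_def, M.proj_comp]
    simp only [timesMap, Equiv.symm_apply_apply]
  comp_proj g := by
    funext j
    simp only [proj, M.reindex_reindex, Function.comp_def]
    convert M.comp_proj (g j) using 5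
    simp only [timesMap, Equiv.symm_apply_apply, Prod.mk.eta, Equiv.apply_symm_apply]
  assoc h g f := by
    funext i
    rw [← M.assoc]

/-- The action of the representable completion on `[𝓕, Set]`-functors. -/
def _root_.MonadTheory.FSetFunctor.completion {M N : FSetCat.{u, v}} (F : FSetFunctor M N) :
    FSetFunctor M.completion N.completion where
  obj X := ⟨F.obj X.base, X.exp⟩
  map f := fun i => F.map (f i)
  map_reindex φ f := funext fun i => F.map_reindex _ _
  map_one X := funext fun i => by
    simp [FSetCat.completion, proj, F.map_reindex, F.map_one]
  map_comp g f := funext fun i => F.map_comp _ _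

end FSetCat

/-! ### From finitary monads to Lawvere theories -/

section Suspension

variable (T : Monad (Type u))

/-- The Kleisli extension `T m → T n` of a map `m → T n`, for a monad `T` on sets. -/
def extend {X Y : Type u} (f : X → T.obj Y) (t : T.obj X) : T.obj Y :=
  T.μ.app Y (T.map (↾f) t)

theorem extend_η {X Y : Type u} (f : X → T.obj Y) (x : X) : extend T f (T.η.app X x) = f x := by
  have h₁ := ConcreteCategory.congr_hom (T.η.naturality (↾f)) x
  have h₂ := ConcreteCategory.congr_hom (T.left_unit Y) (f x)
  simp only [types_comp_apply, Functor.id_map, types_id_apply, TypeCat.ofHom_apply] at h₁ h₂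
  rw [extend, ← h₁]
  exact h₂

theorem extend_id {X : Type u} (t : T.obj X) : extend T (fun x => T.η.app X x) t = t :=
  ConcreteCategory.congr_hom (T.right_unit X) t

theorem map_eq_extend {X Y : Type u} (f : X → Y) (t : T.obj X) :
    T.map (↾f) t = extend T (fun x => T.η.app Y (f x)) t := by
  have h := ConcreteCategory.congr_hom (T.right_unit Y) (T.map (↾f) t)
  simp only [types_comp_apply, types_id_apply] at h
  rw [extend, show (↾fun x => T.η.app Y (f x)) = ↾f ≫ T.η.app Y from rfl, T.map_comp]
  exact h.symm

theorem extend_extend {X Y Z : Type u} (f : X → T.obj Y) (g : Y → T.obj Z) (t : T.obj X) :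
    extend T g (extend T f t) = extend T (fun x => extend T g (f x)) t := by
  have h₁ := ConcreteCategory.congr_hom (T.μ.naturality (↾g)) (T.map (↾f) t)
  have h₂ := ConcreteCategory.congr_hom (T.assoc Z) (T.map (T.map (↾g)) (T.map (↾f) t))
  simp only [types_comp_apply] at h₁ h₂
  rw [extend, extend, extend,
    show (↾fun x => extend T g (f x)) = ↾f ≫ T.map (↾g) ≫ T.μ.app Z from rfl,
    T.map_comp, T.map_comp]
  refine Eq.trans (congrArg _ h₁.symm) h₂.symm

/-- The one-object `[𝓕, Set]`-category `ΣT` of a monad `T` on sets: its `n`-ary morphisms are the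
elements of `T n`, and its composition is that of the monad. -/
def suspension : FSetCat.{u, u} where
  Obj := PUnit
  Hom _ _ n := T.obj (ULift (Fin n))
  reindex φ t := T.map (↾fun s : ULift _ => ULift.up (φ s.down)) t
  one _ := T.η.app (ULift (Fin 1)) ⟨0⟩
  comp g f := extend T (fun s => f s.down) g
  reindex_id t := by
    rw [map_eq_extend]
    exact extend_id T t
  reindex_reindex φ ψ t := by
    simp only [map_eq_extend, extend_extend, extend_η, Function.comp]
  reindex_comp φ g f := by
    simp only [map_eq_extend, extend_extend]
  comp_reindex φ g f := by
    simp only [map_eq_extend, extend_extend, extend_η]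
  proj_comp i f := by
    simp only [map_eq_extend, extend_η]
  comp_proj g := by
    simp only [map_eq_extend, extend_η]
    exact extend_id T g
  assoc h g f := by
    simp only [extend_extend]

variable {T}

/-- The action of `Σ` on monad morphisms. -/
def suspensionMap {S : Monad (Type u)} (α : S ⟶ T) :
    FSetFunctor (suspension S) (suspension T) where
  obj X := X
  map {_ _ n} t := α.app (ULift (Fin n)) t
  map_reindex φ t := ConcreteCategory.congr_hom (α.naturality _) t
  map_one _ := ConcreteCategory.congr_hom (α.app_η _) _
  map_comp {_ _ _ m n} g f := by
    have h := ConcreteCategory.congr_hom (α.app_μ (ULift (Fin n)))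
      (S.map (↾fun s : ULift (Fin m) => f s.down) g)
    refine h.trans (congrArg (fun t => T.μ.app (ULift (Fin n)) t) ?_)
    have h' := ConcreteCategory.congr_hom
      (α.naturality ((↾fun s : ULift (Fin m) => f s.down) ≫ α.app (ULift (Fin n)))) g
    have e := ConcreteCategory.congr_hom
      (S.map_comp (↾fun s : ULift (Fin m) => f s.down) (α.app (ULift (Fin n)))) g
    exact (congrArg (fun t => α.app (T.obj (ULift (Fin n))) t) e.symm).trans h'

end Suspension

/-- The Lawvere theory of a monad `T`: the underlying category of the representable completion
`L(ΣT)` of `ΣT`, with distinguished object `X ^ (1)`, where `X` is the unique object of `ΣT`. -/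
def theory (T : Monad (Type u)) : LawvereTheory.{u} where
  Obj := (suspension T).completion.Underlying
  pow n := ⟨⟨PUnit.unit, n⟩⟩
  pow_bijective := ⟨fun m n h => congrArg (fun X => X.obj.exp) h, fun X => ⟨X.obj.exp, rfl⟩⟩
  π n i := fun _ => (suspension T).proj PUnit.unit (finProdFinEquiv (i, 0))
  isPower n := by
    refine (fan_isLimit_iff _ _).2 fun Z => ?_
    have key : ∀ (g : Z ⟶ (⟨⟨PUnit.unit, n⟩⟩ : (suspension T).completion.Underlying)) (i : Fin n),
        (suspension T).completion.comp (X := Z.obj) (Y := ⟨PUnit.unit, n⟩) (Z := ⟨PUnit.unit, 1⟩)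
          (fun _ => (suspension T).proj PUnit.unit (finProdFinEquiv (i, (0 : Fin 1))))
          (fun _ => g) = fun _ => g i := by
      intro g i
      funext j
      refine ((suspension T).proj_comp (X := Z.obj.base) (finProdFinEquiv (i, (0 : Fin 1)))
        (fun s => g (finProdFinEquiv.symm s).1)).trans ?_
      simp only [Equiv.symm_apply_apply]
    refine ⟨fun g g' h => ?_, fun k => ⟨fun i => k i 0, ?_⟩⟩
    · funext i
      have h' := congrFun h i
      exact congrFun ((key g i).symm.trans (h'.trans (key g' i))) 0
    · funext i
      refine (key _ i).trans ?_
      funext j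
      rw [Subsingleton.elim j 0]
  π_one := by
    funext j
    rw [Subsingleton.elim j 0]
    rfl

/-- The functor sending a finitary monad `T` to its Lawvere theory `L(ΣT)`. -/
def theoryFunctor : FinitaryMonad.{u} ⥤ LawvereTheory.{u} where
  obj T := theory T.obj
  map {S T} α := ⟨(suspensionMap α.hom).completion.underlying, fun _ => rfl, fun n i => by
    refine Eq.trans ?_
      ((Category.id_comp _).trans (Category.comp_id ((theory T.obj).π n i))).symm
    funext j
    refine ((suspensionMap α.hom).map_reindex
      (fun _ => finProdFinEquiv (i, (0 : Fin 1))) ((suspension S.obj).one PUnit.unit)).trans ?_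
    exact congrArg _ ((suspensionMap α.hom).map_one PUnit.unit)⟩
  map_id T := rfl
  map_comp α β := rfl

end MonadTheory

namespace MonadTheory

/-! Finitary monads and Lawvere theories are two presentations of one combinatorial object, an
abstract clone: sets of `n`-ary operations with variables and substitution. Both sides are compared
with `Clone`.

A finitary monad `T` has the clone `n ↦ T n`. Every element of `T X` is the image of some `θ ∈ T n`
under a map `n → X`, so a monad morphism is determined by its values on finite cardinals, and a
clone morphism extends to all sets by evaluation in free algebras (`monadHomOfClone`). Conversely,
each clone is that of its term monad (`Clone.monadCloneMonadIso`), which is finitary because a term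
has finitely many variables. Hence `finitaryMonadClone` is fully faithful and essentially
surjective.

A Lawvere theory has the clone `n ↦ Hom(X ^ n, X)`. A morphism into `X ^ n` is an `n`-tuple of
operations, so `toClone` is fully faithful. Since `theoryFunctor ⋙ toClone` is isomorphic to
`finitaryMonadClone` (`theoryFunctorCompToCloneIso`), `theoryFunctor` is itself an equivalence.

Algebras follow the same pattern. Eilenberg–Moore algebras of a finitary monad are the algebras of
its clone (`algebraToClone_isEquivalence`), and models embed fully faithfully in the algebras of the
clone of the theory. The comparison `A ↦ (X ^ n ↦ A ^ n)` commutes with these passages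
(`algebraToModelCompIso`), so it is an equivalence. Restriction along a monad morphism does not
change carriers, so the naturality isomorphisms have identity components and the coherence laws are
immediate.

The recurring device is `exists_finite_retract`: an equation involving finitely many elements of a
set is pushed along `r` to a finite cardinal, then pulled back along `i`. -/

/-! ### Finite retracts -/

/-- A finite family in `X` is fixed by an idempotent of `X` that factors through a finite
cardinal. -/
theorem exists_finite_retract {X : Type*} {J : Type*} [Finite J] (x : J → X) :
    ∃ (p : ℕ) (i : Fin p → X) (r : X → Fin p), ∀ j, i (r (x j)) = x j := by
  rcases isEmpty_or_nonempty X with hX | ⟨⟨x₀⟩⟩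
  · exact ⟨0, Fin.elim0, fun a => hX.elim a, fun j => hX.elim (x j)⟩
  -- The extra point `none`, sent to `x₀`, keeps `Fin p` inhabited even for empty `J`, as
  -- `Function.invFun` requires.
  · obtain ⟨p, ⟨e⟩⟩ := Finite.exists_equiv_fin (Option J)
    have : Nonempty (Fin p) := ⟨e none⟩
    let i : Fin p → X := fun a => (e.symm a).elim x₀ x
    exact ⟨p, i, Function.invFun i, fun j => Function.invFun_eq ⟨e (some j), by simp [i]⟩⟩

/-! ### Clones and their algebras -/

/-- An abstract clone: a family of sets of `n`-ary operations with variables and simultaneous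
substitution. -/
structure Clone where
  /-- The `n`-ary operations. -/
  Op : ℕ → Type u
  /-- The variables. -/
  var {n : ℕ} (i : Fin n) : Op n
  /-- Simultaneous substitution. -/
  subst {m n : ℕ} (θ : Op m) (σ : Fin m → Op n) : Op n
  var_subst {m n : ℕ} (i : Fin m) (σ : Fin m → Op n) : subst (var i) σ = σ i
  subst_var {n : ℕ} (θ : Op n) : subst θ var = θ
  subst_subst {l m n : ℕ} (θ : Op l) (σ : Fin l → Op m) (τ : Fin m → Op n) :
    subst (subst θ σ) τ = subst θ (fun i => subst (σ i) τ)

namespace Clone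

/-- A morphism of clones. -/
@[ext]
structure Hom (C D : Clone.{u}) where
  /-- The action on operations. -/
  toFun {n : ℕ} : C.Op n → D.Op n
  map_var {n : ℕ} (i : Fin n) : toFun (C.var i) = D.var i
  map_subst {m n : ℕ} (θ : C.Op m) (σ : Fin m → C.Op n) :
    toFun (C.subst θ σ) = D.subst (toFun θ) (fun i => toFun (σ i))

instance : Category Clone.{u} where
  Hom := Hom
  id C := ⟨id, fun _ => rfl, fun _ _ => rfl⟩
  comp f g := ⟨fun θ => g.toFun (f.toFun θ), fun i => by rw [f.map_var, g.map_var],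
    fun θ σ => by rw [f.map_subst, g.map_subst]⟩

theorem hom_ext {C D : Clone.{u}} {f g : C ⟶ D}
    (h : ∀ (n : ℕ) (θ : C.Op n), Hom.toFun f θ = Hom.toFun g θ) : f = g :=
  Hom.ext (funext fun n => funext fun θ => h n θ)

/-- An isomorphism of clones from bijections on operations compatible with the structure. -/
def isoOfEquiv {C D : Clone.{u}} (e : ∀ n, C.Op n ≃ D.Op n)
    (hvar : ∀ {n : ℕ} (i : Fin n), e n (C.var i) = D.var i)
    (hsubst : ∀ {m n : ℕ} (θ : C.Op m) (σ : Fin m → C.Op n),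
      e n (C.subst θ σ) = D.subst (e m θ) (fun i => e n (σ i))) : C ≅ D where
  hom := ⟨fun {n} θ => e n θ, hvar, hsubst⟩
  inv := ⟨fun {n} θ => (e n).symm θ, fun i => by rw [← hvar, Equiv.symm_apply_apply],
    fun θ σ => by rw [Equiv.symm_apply_eq, hsubst]; simp only [Equiv.apply_symm_apply]⟩
  hom_inv_id := hom_ext fun n θ => (e n).symm_apply_apply θ
  inv_hom_id := hom_ext fun n θ => (e n).apply_symm_apply θ

/-- An algebra for a clone. -/
structure Algebra (C : Clone.{u}) where
  /-- The underlying set. -/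
  carrier : Type u
  /-- The action of the operations. -/
  op {n : ℕ} (θ : C.Op n) (x : Fin n → carrier) : carrier
  op_var {n : ℕ} (i : Fin n) (x : Fin n → carrier) : op (C.var i) x = x i
  op_subst {m n : ℕ} (θ : C.Op m) (σ : Fin m → C.Op n) (x : Fin n → carrier) :
    op (C.subst θ σ) x = op θ (fun i => op (σ i) x)

namespace Algebra

variable {C : Clone.{u}}

/-- A homomorphism of algebras for a clone. -/
@[ext]
structure Hom (A B : C.Algebra) where
  /-- The underlying map. -/
  toFun : A.carrier → B.carrier
  map_op {n : ℕ} (θ : C.Op n) (x : Fin n → A.carrier) :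
    toFun (A.op θ x) = B.op θ (fun i => toFun (x i))

instance : Category C.Algebra where
  Hom := Hom
  id A := ⟨id, fun _ _ => rfl⟩
  comp f g := ⟨fun a => g.toFun (f.toFun a), fun θ x => by rw [f.map_op, g.map_op]⟩

theorem hom_ext {A B : C.Algebra} {f g : A ⟶ B} (h : ∀ a, Hom.toFun f a = Hom.toFun g a) :
    f = g :=
  Hom.ext (funext h)

/-- An isomorphism of algebras from a bijective homomorphism. -/
def isoOfEquiv {A B : C.Algebra} (e : A.carrier ≃ B.carrier)
    (he : ∀ {n : ℕ} (θ : C.Op n) (x : Fin n → A.carrier),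
      e (A.op θ x) = B.op θ (fun i => e (x i))) : A ≅ B where
  hom := ⟨e, he⟩
  inv := ⟨e.symm, fun θ x => by rw [Equiv.symm_apply_eq, he]; simp only [Equiv.apply_symm_apply]⟩
  hom_inv_id := hom_ext fun a => e.symm_apply_apply a
  inv_hom_id := hom_ext fun a => e.apply_symm_apply a

/-- The forgetful functor from algebras for a clone to sets. -/
def forget (C : Clone.{u}) : C.Algebra ⥤ Type u where
  obj A := A.carrier
  map f := ↾(Hom.toFun f)

/-- Restriction of algebras along a morphism of clones. -/
def restrict {D : Clone.{u}} (f : C ⟶ D) : D.Algebra ⥤ C.Algebra where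
  obj A :=
    { carrier := A.carrier
      op := fun θ x => A.op (Clone.Hom.toFun f θ) x
      op_var := fun i x => by rw [Clone.Hom.map_var, A.op_var]
      op_subst := fun θ σ x => by rw [Clone.Hom.map_subst, A.op_subst] }
  map {A B} g := ⟨Hom.toFun (A := A) (B := B) g, fun θ x => Hom.map_op (A := A) (B := B) g _ x⟩

/-- Every operation of `D` is the `f`-image of one of `C`, so a homomorphism of restricted algebras
already respects all of `D`; restriction along `inv f` supplies preimages of objects. -/
instance restrict_isEquivalence {D : Clone.{u}} (f : C ⟶ D) [IsIso f] :
    (restrict f).IsEquivalence where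
  faithful := ⟨fun {A B} g g' h => hom_ext fun a => congrFun
    (congrArg (Hom.toFun (A := (restrict f).obj A) (B := (restrict f).obj B)) h) a⟩
  full := ⟨fun {A B} (g : Hom ((restrict f).obj A) ((restrict f).obj B)) =>
    ⟨Hom.mk (A := A) (B := B) g.toFun fun {n} θ x => by
      have h := g.map_op (Clone.Hom.toFun (inv f) θ) x
      change g.toFun (A.op (Clone.Hom.toFun (inv f ≫ f) θ) x) =
        B.op (Clone.Hom.toFun (inv f ≫ f) θ) (fun i => g.toFun (x i)) at h
      rwa [IsIso.inv_hom_id] at h, rfl⟩⟩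
  essSurj := ⟨fun A => ⟨(restrict (inv f)).obj A, ⟨isoOfEquiv (Equiv.refl _) fun θ x => by
    change A.op (Clone.Hom.toFun (f ≫ inv f) θ) x = _
    rw [IsIso.hom_inv_id]
    rfl⟩⟩⟩

end Algebra

/-! ### Free algebras -/

variable (C : Clone.{u})

/-- The terms of a clone with variables in a set `X`, each given by the family of its values under
renamings of the variables in finite cardinals. -/
def Term (X : Type u) : Type u :=
  {t : ∀ k : ℕ, (X → Fin k) → C.Op k //
    ∃ (n : ℕ) (θ : C.Op n) (x : Fin n → X), ∀ k h, t k h = C.subst θ (fun i => C.var (h (x i)))}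

namespace Term

variable {C} {X : Type u}

/-- The term `θ(x₁, …, xₙ)`. -/
def mk {n : ℕ} (θ : C.Op n) (x : Fin n → X) : Term C X :=
  ⟨fun _ h => C.subst θ (fun i => C.var (h (x i))), n, θ, x, fun _ _ => rfl⟩

theorem exists_mk (t : Term C X) : ∃ (n : ℕ) (θ : C.Op n) (x : Fin n → X), mk θ x = t := by
  obtain ⟨t, n, θ, x, h⟩ := t
  exact ⟨n, θ, x, Subtype.ext (funext fun k => funext fun g => (h k g).symm)⟩

theorem mk_rename {m n : ℕ} (φ : Fin m → Fin n) (θ : C.Op m) (x : Fin n → X) :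
    mk (C.subst θ (fun i => C.var (φ i))) x = mk θ (fun i => x (φ i)) := by
  refine Subtype.ext (funext fun k => funext fun g => ?_)
  simp only [mk, C.subst_subst, C.var_subst]

/-- Finitely many terms can be written with the same finitely many variables. -/
theorem exists_common_mk {J : Type*} [Finite J] (t : J → Term C X) :
    ∃ (p : ℕ) (θ : J → C.Op p) (x : Fin p → X), ∀ j, mk (θ j) x = t j := by
  -- All variables of all the terms form one finite family; the retraction renames them into `Fin p`
  -- without changing the terms.
  choose n θ x h using fun j => exists_mk (t j)
  obtain ⟨p, i, r, hr⟩ := exists_finite_retract (fun a : Σ j, Fin (n j) => x a.1 a.2)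
  refine ⟨p, fun j => C.subst (θ j) (fun a => C.var (r (x j a))), i, fun j => ?_⟩
  rw [mk_rename, ← h j]
  exact congrArg _ (funext fun a => hr ⟨j, a⟩)

/-- The free algebra on a set. -/
def algebra (C : Clone.{u}) (X : Type u) : C.Algebra where
  carrier := Term C X
  op θ t := ⟨fun k h => C.subst θ (fun i => (t i).1 k h), by
    -- The result must again be written with a single variable list, so the arguments are first put
    -- over common variables.
    obtain ⟨p, σ, x, h⟩ := exists_common_mk t
    refine ⟨p, C.subst θ σ, x, fun k g => ?_⟩
    simp only [← h, mk, C.subst_subst]⟩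
  op_var i t := Subtype.ext (funext fun k => funext fun g => C.var_subst _ _)
  op_subst θ σ t := Subtype.ext (funext fun k => funext fun g => C.subst_subst _ _ _)

theorem op_mk {m n : ℕ} (θ : C.Op m) (σ : Fin m → C.Op n) (x : Fin n → X) :
    (algebra C X).op θ (fun i => mk (σ i) x) = mk (C.subst θ σ) x :=
  Subtype.ext (funext fun _ => funext fun _ => (C.subst_subst _ _ _).symm)

/-- A variable as a term. -/
def ofVar (x : X) : Term C X := mk (n := 1) (C.var 0) (fun _ => x)

theorem mk_var {n : ℕ} (i : Fin n) (x : Fin n → X) : mk (C.var i) x = ofVar (x i) := by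
  refine Subtype.ext (funext fun k => funext fun g => ?_)
  simp only [mk, ofVar, C.var_subst]

/-- Variables generate the free algebra, which gives the uniqueness half of its universal property.
-/
theorem mk_eq_op {n : ℕ} (θ : C.Op n) (x : Fin n → X) :
    mk θ x = (algebra C X).op θ (fun i => ofVar (x i)) := by
  simp only [← mk_var, op_mk, C.subst_var]

/-- This is the well-definedness of evaluation. The two terms agree in particular at a renaming `r`
whose retraction fixes every variable of both lists; evaluating that identity of `p`-ary operations
at `g ∘ i` gives the claim. -/
theorem op_eq_of_mk_eq (A : C.Algebra) (g : X → A.carrier) {m n : ℕ} {θ : C.Op m} {θ' : C.Op n}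
    {x : Fin m → X} {x' : Fin n → X} (h : mk θ x = mk θ' x') :
    A.op θ (fun i => g (x i)) = A.op θ' (fun i => g (x' i)) := by
  obtain ⟨p, i, r, hr⟩ := exists_finite_retract (Sum.elim x x')
  have hx : x = fun a => i (r (x a)) := funext fun a => (hr (Sum.inl a)).symm
  have hx' : x' = fun a => i (r (x' a)) := funext fun a => (hr (Sum.inr a)).symm
  have e : C.subst θ (fun a => C.var (r (x a))) = C.subst θ' (fun a => C.var (r (x' a))) :=
    congrFun (congrFun (congrArg Subtype.val h) p) r
  have := congrArg (fun ω => A.op ω (fun a => g (i a))) e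
  simp only [A.op_subst, A.op_var] at this
  rw [hx, hx']
  exact this

/-- The value of a term in an algebra. -/
noncomputable def eval (A : C.Algebra) (g : X → A.carrier) (t : Term C X) : A.carrier :=
  A.op t.exists_mk.choose_spec.choose (fun i => g (t.exists_mk.choose_spec.choose_spec.choose i))

theorem eval_mk (A : C.Algebra) (g : X → A.carrier) {n : ℕ} (θ : C.Op n) (x : Fin n → X) :
    eval A g (mk θ x) = A.op θ (fun i => g (x i)) :=
  op_eq_of_mk_eq A g (mk θ x).exists_mk.choose_spec.choose_spec.choose_spec

theorem eval_ofVar (A : C.Algebra) (g : X → A.carrier) (x : X) : eval A g (ofVar x) = g x :=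
  (eval_mk A g _ _).trans (A.op_var _ _)

/-- Over common variables the operation becomes a substitution, which algebras respect. -/
theorem eval_op (A : C.Algebra) (g : X → A.carrier) {n : ℕ} (θ : C.Op n) (t : Fin n → Term C X) :
    eval A g ((algebra C X).op θ t) = A.op θ (fun i => eval A g (t i)) := by
  obtain ⟨p, σ, x, h⟩ := exists_common_mk t
  obtain rfl : (fun i => mk (σ i) x) = t := funext h
  simp only [op_mk, eval_mk, A.op_subst]

/-- The universal property of the free algebra. -/
noncomputable def homEquiv (X : Type u) (A : C.Algebra) :
    (algebra C X ⟶ A) ≃ (X ⟶ (Algebra.forget C).obj A) where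
  toFun f := ↾fun x => Algebra.Hom.toFun f (ofVar x)
  invFun g := ⟨eval A g, fun θ t => eval_op A g θ t⟩
  left_inv f := Algebra.hom_ext fun t => by
    obtain ⟨n, θ, x, rfl⟩ := exists_mk t
    refine (eval_mk A _ θ x).trans ?_
    rw [mk_eq_op]
    exact (Algebra.Hom.map_op f θ _).symm
  right_inv g := ConcreteCategory.hom_ext _ _ fun x => eval_ofVar A g x

end Term

/-- The adjunction between free algebras and the forgetful functor. -/
noncomputable def freeAdjunction :
    Adjunction.leftAdjointOfEquiv (G := Algebra.forget C) (Term.homEquiv (C := C))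
      (fun _ _ _ _ _ => rfl) ⊣ Algebra.forget C :=
  Adjunction.adjunctionOfEquivLeft _ _

/-- The monad of terms of a clone. -/
noncomputable def monad : Monad (Type u) := C.freeAdjunction.toMonad

end Clone

/-! ### Finitary endofunctors of the category of sets -/

theorem map_map_apply (F : Type u ⥤ Type u) {X Y Z : Type u} (f : X → Y) (g : Y → Z)
    (t : F.obj X) : F.map (↾g) (F.map (↾f) t) = F.map (↾fun x => g (f x)) t :=
  (ConcreteCategory.congr_hom (F.map_comp (↾f) (↾g)) t).symm

/-- Every element of the value of a finitary endofunctor comes from a finite cardinal. -/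
theorem exists_map_eq (F : Type u ⥤ Type u) [PreservesFilteredColimits F] {X : Type u}
    (t : F.obj X) : ∃ (n : ℕ) (x : Fin n → X) (θ : F.obj (ULift (Fin n))),
      F.map (↾fun s : ULift (Fin n) => x s.down) θ = t := by
  -- `X` is the filtered colimit of its finite subsets, and `F` preserves this colimit.
  have := HasCardinalLT.Set.isFiltered_of_aleph0_le X Cardinal.aleph0 le_rfl
  obtain ⟨⟨A, hA⟩, θ, h⟩ := Types.jointly_surjective_of_isColimit
    (isColimitOfPreserves F (HasCardinalLT.Set.isColimitCocone X Cardinal.aleph0 le_rfl)) t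
  have : Finite A := (hasCardinalLT_aleph0_iff _).1 hA
  obtain ⟨n, ⟨e⟩⟩ := Finite.exists_equiv_fin A
  refine ⟨n, fun i => (e.symm i).1, F.map (↾fun a : A => ULift.up (e a)) θ, ?_⟩
  refine (map_map_apply F _ _ _).trans (Eq.trans ?_ h)
  simp only [Equiv.symm_apply_apply]
  rfl

/-- An endofunctor of the category of sets whose elements come from finite cardinals is
finitary. -/
theorem preservesFilteredColimits_of_exists_map_eq (F : Type u ⥤ Type u)
    (hF : ∀ {X : Type u} (t : F.obj X), ∃ (n : ℕ) (x : Fin n → X) (θ : F.obj (ULift (Fin n))),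
      F.map (↾fun s : ULift (Fin n) => x s.down) θ = t) : PreservesFilteredColimits F := by
  refine ⟨fun J _ _ => ⟨fun {D} => ⟨fun {c} hc => ⟨?_⟩⟩⟩⟩
  have := Cardinal.fact_isRegular_aleph0
  have hfin : ∀ n : ℕ, IsFinitelyPresentable.{u} (ULift.{u} (Fin n)) := fun n =>
    HasCardinalLT.isCardinalPresentable (hasCardinalLT_of_finite _ _ le_rfl)
  refine Types.FilteredColimit.isColimitOf' _ _ (fun t => ?_) (fun j t t' h => ?_)
  -- Joint surjectivity: finite cardinals are finitely presentable, so `x` lifts to a stage of the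
  -- diagram.
  · obtain ⟨n, x, θ, rfl⟩ := hF t
    obtain ⟨j, y, hy⟩ := IsFinitelyPresentable.exists_hom_of_isColimit hc
      (↾fun s : ULift (Fin n) => x s.down)
    exact ⟨j, F.map y θ, by rw [← hy, F.map_comp]; rfl⟩
  · obtain ⟨m, x, θ, rfl⟩ := hF t
    obtain ⟨n, x', θ', rfl⟩ := hF t'
    -- The retraction lives on the colimit; its section `i` is lifted to a map `y` at a stage `k`.
    obtain ⟨p, i, r, hr⟩ := exists_finite_retract
      (Sum.elim (fun a => c.ι.app j (x a)) (fun a => c.ι.app j (x' a)))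
    obtain ⟨k, y, hy⟩ := IsFinitelyPresentable.exists_hom_of_isColimit hc
      (↾fun s : ULift (Fin p) => i s.down)
    -- a stage at which a finite family of elements is fixed by the retraction
    have key : ∀ (n : ℕ) (z : Fin n → D.obj j), (∀ a, i (r (c.ι.app j (z a))) = c.ι.app j (z a)) →
        ∃ (l : J) (f : k ⟶ l) (g : j ⟶ l), ∀ a,
          D.map g (z a) = D.map f (y ⟨r (c.ι.app j (z a))⟩) := by
      intro n z hz
      obtain ⟨l, g, f, e⟩ := IsFinitelyPresentable.exists_eq_of_isColimit hc
        (↾fun s : ULift (Fin n) => z s.down)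
        ((↾fun s : ULift (Fin n) => ULift.up (r (c.ι.app j (z s.down)))) ≫ y) (by
          rw [Category.assoc, hy]
          exact ConcreteCategory.hom_ext _ _ fun s => (hz s.down).symm)
      exact ⟨l, f, g, fun a => ConcreteCategory.congr_hom e ⟨a⟩⟩
    -- Concatenating the two families yields one stage `l` that serves both.
    obtain ⟨l, f, g, e⟩ := key (m + n) (Fin.append x x') (fun a => by
      refine Fin.addCases (fun a => ?_) (fun a => ?_) a
      · rw [Fin.append_left]
        exact hr (Sum.inl a)
      · rw [Fin.append_right]
        exact hr (Sum.inr a))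
    refine ⟨l, g, ?_⟩
    -- At stage `l` the image of the element depends only on its image in `F` of the colimit, via
    -- `r` and `y`; elements identified in the colimit therefore agree there.
    have factor : ∀ {n : ℕ} (z : Fin n → D.obj j) (ω : F.obj (ULift (Fin n))),
        (∀ a, D.map g (z a) = D.map f (y ⟨r (c.ι.app j (z a))⟩)) →
        F.map (D.map g) (F.map (↾fun s : ULift (Fin n) => z s.down) ω) =
          F.map (↾fun b => D.map f (y ⟨r b⟩))
            (F.map (c.ι.app j) (F.map (↾fun s : ULift (Fin n) => z s.down) ω)) := by
      intro n z ω hz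
      refine (map_map_apply F _ (D.map g) ω).trans (Eq.trans ?_
        (congrArg _ (map_map_apply F _ (c.ι.app j) ω)).symm)
      rw [map_map_apply]
      simp only [hz]
    refine (factor x θ fun a => ?_).trans ((congrArg _ h).trans (factor x' θ' fun a => ?_).symm)
    · simpa only [Fin.append_left] using e (Fin.castAdd n a)
    · simpa only [Fin.append_right] using e (Fin.natAdd m a)

/-! ### The clone of a monad -/

/-- The clone of a monad on sets, with `n`-ary operations the elements of `T n`. -/
def monadClone : Monad (Type u) ⥤ Clone.{u} where
  obj T :=
    { Op := fun n => T.obj (ULift (Fin n))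
      var := fun {n} i => T.η.app (ULift (Fin n)) ⟨i⟩
      subst := fun {m n} θ σ =>
        extend T (X := ULift (Fin m)) (Y := ULift (Fin n)) (fun s => σ s.down) θ
      var_subst := fun _ _ => extend_η T _ _
      subst_var := fun {n} θ => extend_id T (X := ULift (Fin n)) θ
      subst_subst := fun _ _ _ => extend_extend T _ _ _ }
  map α :=
    { toFun := fun {n} θ => α.app (ULift (Fin n)) θ
      map_var := fun _ => ConcreteCategory.congr_hom (α.app_η _) _
      map_subst := fun θ σ =>
        (suspensionMap α).map_comp (X := PUnit.unit) (Y := PUnit.unit) (Z := PUnit.unit) θ σ }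
  map_id _ := rfl
  map_comp _ _ := rfl

section

variable (T : Monad (Type u))

theorem extend_self {X : Type u} (t : T.obj (T.obj X)) :
    extend T (fun s : T.obj X => s) t = T.μ.app X t :=
  congrArg (T.μ.app X) (ConcreteCategory.congr_hom (T.map_id (T.obj X)) t)

theorem algebra_unit_apply (A : T.Algebra) (a : A.A) : A.a (T.η.app A.A a) = a :=
  ConcreteCategory.congr_hom A.unit a

theorem algebra_extend (A : T.Algebra) {X : Type u} (f : X → T.obj A.A) (t : T.obj X) :
    A.a (extend T f t) = A.a (T.map (↾fun x => A.a (f x)) t) :=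
  (ConcreteCategory.congr_hom A.assoc (T.map (↾f) t)).trans
    (congrArg A.a (map_map_apply T.toFunctor f A.a t))

/-- Associativity of the action in substitution form: it gives both the clone-algebra law and the
functoriality of `algebraPowers`. -/
theorem algebra_map_extend (A : T.Algebra) {X Y : Type u} (f : X → T.obj Y) (g : Y → A.A)
    (t : T.obj X) :
    A.a (T.map (↾g) (extend T f t)) = A.a (T.map (↾fun x => A.a (T.map (↾g) (f x))) t) := by
  rw [map_eq_extend, extend_extend, algebra_extend]
  simp only [← map_eq_extend]

/-- An Eilenberg–Moore algebra as an algebra for the clone of the monad. -/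
def algebraToClone : T.Algebra ⥤ (monadClone.obj T).Algebra where
  obj A :=
    { carrier := A.A
      op := fun {n} θ x => A.a (T.map (↾fun s : ULift (Fin n) => x s.down) θ)
      op_var := fun {n} i x => by
        refine (congrArg A.a (ConcreteCategory.congr_hom (T.η.naturality
          (↾fun s : ULift (Fin n) => x s.down)) ⟨i⟩).symm).trans ?_
        exact algebra_unit_apply T A _
      op_subst := fun θ σ x => algebra_map_extend T A _ _ _ }
  map {A B} f := ⟨f.f, fun {n} θ x => by
    refine (ConcreteCategory.congr_hom f.h
      (T.map (↾fun s : ULift (Fin n) => x s.down) θ)).symm.trans ?_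
    exact congrArg B.a (map_map_apply T.toFunctor _ f.f θ)⟩

instance : (algebraToClone T).Faithful where
  map_injective h := Monad.Algebra.Hom.ext (ConcreteCategory.hom_ext _ _ fun a =>
    congrFun (congrArg Clone.Algebra.Hom.toFun h) a)

variable {T}

theorem op_rename (B : (monadClone.obj T).Algebra) {m n : ℕ} (φ : Fin m → Fin n)
    (θ : T.obj (ULift (Fin m))) (x : Fin n → B.carrier) :
    B.op (n := n) (T.map (↾fun s : ULift (Fin m) => ULift.up (φ s.down)) θ) x =
      B.op (n := m) θ (fun i => x (φ i)) := by
  rw [map_eq_extend]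
  refine (B.op_subst (m := m) θ (fun i => (monadClone.obj T).var (φ i)) x).trans ?_
  simp only [B.op_var]

/-- The counterpart of `Clone.Term.op_eq_of_mk_eq`: apply `T r` to the equation, landing in `T p`,
and evaluate at `g ∘ i`. It makes `evalClone` independent of the chosen representation. -/
theorem op_eq_of_map_eq (B : (monadClone.obj T).Algebra) {X : Type u} (g : X → B.carrier)
    {m n : ℕ} {θ : T.obj (ULift (Fin m))} {θ' : T.obj (ULift (Fin n))} {x : Fin m → X}
    {x' : Fin n → X} (h : T.map (↾fun s : ULift (Fin m) => x s.down) θ =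
      T.map (↾fun s : ULift (Fin n) => x' s.down) θ') :
    B.op (n := m) θ (fun i => g (x i)) = B.op (n := n) θ' (fun i => g (x' i)) := by
  obtain ⟨p, i, r, hr⟩ := exists_finite_retract (Sum.elim x x')
  have hx : x = fun a => i (r (x a)) := funext fun a => (hr (Sum.inl a)).symm
  have hx' : x' = fun a => i (r (x' a)) := funext fun a => (hr (Sum.inr a)).symm
  have e := congrArg (fun t => B.op (n := p) t (fun a => g (i a)))
    (congrArg (T.map (↾fun a => ULift.up (r a))) h)
  simp only [map_map_apply] at e
  rw [op_rename B (fun a => r (x a)), op_rename B (fun a => r (x' a))] at e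
  rw [hx, hx']
  exact e

theorem exists_map_eq_of_isFinitary (hT : isFinitary T) {X : Type u} (t : T.obj X) :
    ∃ (n : ℕ) (x : Fin n → X) (θ : T.obj (ULift (Fin n))),
      T.map (↾fun s : ULift (Fin n) => x s.down) θ = t :=
  have : PreservesFilteredColimits T.toFunctor := hT
  exists_map_eq T.toFunctor t

/-- Finitely many elements of `T X` come from the same finite cardinal. -/
theorem exists_common_map_eq (hT : isFinitary T) {X : Type u} {J : Type*} [Finite J]
    (t : J → T.obj X) : ∃ (p : ℕ) (x : Fin p → X) (θ : J → T.obj (ULift (Fin p))),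
      ∀ j, T.map (↾fun s : ULift (Fin p) => x s.down) (θ j) = t j := by
  choose n x θ h using fun j => exists_map_eq_of_isFinitary hT (t j)
  obtain ⟨p, i, r, hr⟩ := exists_finite_retract (fun a : Σ j, Fin (n j) => x a.1 a.2)
  refine ⟨p, i, fun j => T.map (↾fun s : ULift (Fin (n j)) => ULift.up (r (x j s.down))) (θ j),
    fun j => ?_⟩
  rw [map_map_apply, ← h j]
  exact congrArg (fun f => T.map (↾f) (θ j)) (funext fun s => hr ⟨j, s.down⟩)

/-- The extension to `T X` of a map from `X` to an algebra for the clone of a finitary monad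
`T`. -/
noncomputable def evalClone (hT : isFinitary T) (B : (monadClone.obj T).Algebra) {X : Type u}
    (g : X → B.carrier) (t : T.obj X) : B.carrier :=
  B.op (n := (exists_map_eq_of_isFinitary hT t).choose)
    (exists_map_eq_of_isFinitary hT t).choose_spec.choose_spec.choose
    (fun i => g ((exists_map_eq_of_isFinitary hT t).choose_spec.choose i))

theorem evalClone_map (hT : isFinitary T) (B : (monadClone.obj T).Algebra) {X : Type u}
    (g : X → B.carrier) {n : ℕ} (θ : T.obj (ULift (Fin n))) (x : Fin n → X) :
    evalClone hT B g (T.map (↾fun s : ULift (Fin n) => x s.down) θ) =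
      B.op (n := n) θ (fun i => g (x i)) :=
  op_eq_of_map_eq B g
    (exists_map_eq_of_isFinitary hT _).choose_spec.choose_spec.choose_spec

theorem evalClone_map_apply (hT : isFinitary T) (B : (monadClone.obj T).Algebra) {X Y : Type u}
    (f : X → Y) (g : Y → B.carrier) (t : T.obj X) :
    evalClone hT B g (T.map (↾f) t) = evalClone hT B (fun x => g (f x)) t := by
  obtain ⟨n, x, θ, rfl⟩ := exists_map_eq_of_isFinitary hT t
  rw [map_map_apply, evalClone_map, evalClone_map hT B g θ (fun i => f (x i))]

theorem map_evalClone (hT : isFinitary T) {B B' : (monadClone.obj T).Algebra} (f : B ⟶ B')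
    {X : Type u} (g : X → B.carrier) (t : T.obj X) :
    Clone.Algebra.Hom.toFun f (evalClone hT B g t) =
      evalClone hT B' (fun x => Clone.Algebra.Hom.toFun f (g x)) t := by
  obtain ⟨n, x, θ, rfl⟩ := exists_map_eq_of_isFinitary hT t
  rw [evalClone_map, evalClone_map]
  exact Clone.Algebra.Hom.map_op f (n := n) θ _

theorem map_η_apply {X : Type u} (x : X) :
    T.map (↾fun _ : ULift (Fin 1) => x) (T.η.app (ULift (Fin 1)) ⟨0⟩) = T.η.app X x :=
  (ConcreteCategory.congr_hom (T.η.naturality (↾fun _ : ULift (Fin 1) => x)) ⟨0⟩).symm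

theorem evalClone_η (hT : isFinitary T) (B : (monadClone.obj T).Algebra) {X : Type u}
    (g : X → B.carrier) (x : X) : evalClone hT B g (T.η.app X x) = g x := by
  rw [← map_η_apply, evalClone_map hT B g _ (fun _ => x)]
  exact B.op_var _ _

/-- Only the finitely many values `f (x i)` matter; over a common finite cardinal the Kleisli
extension is a substitution of operations. Associativity of the induced action and compatibility
with `μ` both come from this. -/
theorem evalClone_extend (hT : isFinitary T) (B : (monadClone.obj T).Algebra) {X Y : Type u}
    (f : X → T.obj Y) (g : Y → B.carrier) (t : T.obj X) :
    evalClone hT B g (extend T f t) = evalClone hT B (fun x => evalClone hT B g (f x)) t := by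
  obtain ⟨n, x, θ, rfl⟩ := exists_map_eq_of_isFinitary hT t
  obtain ⟨p, y, σ, h⟩ := exists_common_map_eq hT (fun i => f (x i))
  have e : extend T f (T.map (↾fun s : ULift (Fin n) => x s.down) θ) =
      T.map (↾fun s : ULift (Fin p) => y s.down) (extend T (fun s => σ s.down) θ) := by
    simp only [map_eq_extend, extend_extend, extend_η]
    simp only [← map_eq_extend, h]
  rw [e, evalClone_map, evalClone_map]
  simp only [← h, evalClone_map]
  exact B.op_subst (m := n) θ σ _

/-- The Eilenberg–Moore algebra of an algebra for the clone of a finitary monad. -/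
noncomputable def algebraOfClone (hT : isFinitary T) (B : (monadClone.obj T).Algebra) :
    T.Algebra where
  A := B.carrier
  a := ↾(evalClone hT B id)
  unit := ConcreteCategory.hom_ext _ _ fun b => evalClone_η hT B id b
  assoc := ConcreteCategory.hom_ext _ _ fun t => by
    have e := evalClone_extend hT B (fun s : T.obj B.carrier => s) id t
    rw [extend_self] at e
    exact e.trans (evalClone_map_apply hT B (evalClone hT B id) id t).symm

/-- Each element of `T A` is a finitary operation applied to a tuple, so the full action `T A → A`
and its homomorphisms are determined by the operations. -/
theorem algebraToClone_isEquivalence (hT : isFinitary T) : (algebraToClone T).IsEquivalence where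
  full := ⟨fun {A B} f => ⟨⟨↾(Clone.Algebra.Hom.toFun f), ConcreteCategory.hom_ext _ _ fun t => by
    obtain ⟨n, x, θ, rfl⟩ := exists_map_eq_of_isFinitary hT t
    refine Eq.trans (congrArg B.a (map_map_apply T.toFunctor _ _ θ)) ?_
    exact (Clone.Algebra.Hom.map_op f (n := n) θ x).symm⟩, rfl⟩⟩
  essSurj := ⟨fun B => ⟨algebraOfClone hT B, ⟨Clone.Algebra.isoOfEquiv (Equiv.refl _)
    fun {n} θ x => evalClone_map hT B id θ x⟩⟩⟩

/-! ### Finitary monads as clones -/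

theorem monadHom_eq_of_app_eq {S : Monad (Type u)} (hS : isFinitary S) {α β : S ⟶ T}
    (h : ∀ (n : ℕ) (θ : S.obj (ULift (Fin n))), α.app _ θ = β.app _ θ) : α = β := by
  refine MonadHom.ext (funext fun X => ConcreteCategory.hom_ext _ _ fun t => ?_)
  obtain ⟨n, x, θ, rfl⟩ := exists_map_eq_of_isFinitary hS t
  refine (ConcreteCategory.congr_hom (α.naturality _) θ).trans (Eq.trans ?_
    (ConcreteCategory.congr_hom (β.naturality _) θ).symm)
  exact congrArg _ (h n θ)

/-! ### Monad morphisms from clone morphisms -/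

section

variable {S : Monad (Type u)} (hS : isFinitary S) (f : monadClone.obj S ⟶ monadClone.obj T)

/-- The free `T`-algebra on a set as an algebra for the clone of `S`. -/
abbrev freeRestrict (X : Type u) : (monadClone.obj S).Algebra :=
  (Clone.Algebra.restrict f).obj ((algebraToClone T).obj ((Monad.free T).obj X))

/-- The component of the monad morphism induced by a morphism of clones. -/
noncomputable def monadHomApp (X : Type u) : S.obj X → T.obj X :=
  evalClone hS (freeRestrict f X) (fun x : X => T.η.app X x)

/-- The Kleisli extension of `g` is a homomorphism of free `T`-algebras, and homomorphisms commute
with evaluation. Taking `g` through the unit yields naturality; taking the identity yields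
compatibility with `μ`. -/
theorem monadHomApp_extend {X Y : Type u} (g : X → T.obj Y) (t : S.obj X) :
    extend T g (monadHomApp hS f X t) = evalClone hS (freeRestrict f Y) g t := by
  let A := (Monad.free T).obj X
  let B := (Monad.free T).obj Y
  let k : A ⟶ B := ⟨T.map (↾g) ≫ T.μ.app Y, by
    change T.map (T.map (↾g) ≫ T.μ.app Y) ≫ T.μ.app Y = T.μ.app X ≫ T.map (↾g) ≫ T.μ.app Y
    rw [T.map_comp, Category.assoc, T.assoc]
    exact congrArg (· ≫ T.μ.app Y) (T.μ.naturality (↾g))⟩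
  refine (map_evalClone hS ((Clone.Algebra.restrict f).map ((algebraToClone T).map k)) _ t).trans ?_
  exact congrArg (fun h => evalClone hS (freeRestrict f Y) h t) (funext fun x => extend_η T g x)

/-- The monad morphism induced by a morphism of clones. -/
noncomputable def monadHomOfClone : S ⟶ T where
  app X := ↾(monadHomApp hS f X)
  naturality X Y g := ConcreteCategory.hom_ext _ _ fun t => by
    refine (evalClone_map_apply hS (freeRestrict f Y) g (fun y : Y => T.η.app Y y) t).trans ?_
    exact (monadHomApp_extend hS f (fun x => T.η.app Y (g x)) t).symm.trans
      (map_eq_extend T g _).symm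
  app_η X := ConcreteCategory.hom_ext _ _ fun x =>
    evalClone_η hS (freeRestrict f X) (fun x : X => T.η.app X x) x
  app_μ X := ConcreteCategory.hom_ext _ _ fun t => by
    have e := evalClone_extend hS (freeRestrict f X) (fun s : S.obj X => s)
      (fun x : X => T.η.app X x) t
    rw [extend_self] at e
    have h := monadHomApp_extend hS f (fun s : T.obj X => s) (S.map (↾(monadHomApp hS f X)) t)
    rw [extend_self] at h
    exact e.trans (h.trans (evalClone_map_apply hS (freeRestrict f X) (monadHomApp hS f X)
      (fun s : T.obj X => s) t)).symm

/-- An operation evaluated at the tuple of variables of the free algebra is itself, by the right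
unit law. -/
theorem monadClone_map_monadHomOfClone : monadClone.map (monadHomOfClone hS f) = f := by
  refine Clone.hom_ext fun n θ => ?_
  have h := evalClone_map hS (freeRestrict f (ULift (Fin n)))
    (fun x : ULift (Fin n) => T.η.app (ULift (Fin n)) x) θ ULift.up
  have e : S.map (↾fun s : ULift (Fin n) => ULift.up s.down) θ = θ :=
    ConcreteCategory.congr_hom (S.map_id (ULift (Fin n))) θ
  rw [e] at h
  refine h.trans ?_
  exact ConcreteCategory.congr_hom (T.right_unit (ULift (Fin n))) _

end

end

/-- The functor sending a finitary monad to its clone. -/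
abbrev finitaryMonadClone : FinitaryMonad.{u} ⥤ Clone.{u} := isFinitary.ι ⋙ monadClone

instance : finitaryMonadClone.{u}.Faithful where
  map_injective {S T _ _} h := by
    apply ObjectProperty.hom_ext
    exact monadHom_eq_of_app_eq S.property fun n θ =>
      congrArg (fun f : finitaryMonadClone.obj S ⟶ _ =>
        Clone.Hom.toFun f (n := n) θ) h

instance : finitaryMonadClone.{u}.Full where
  map_surjective {S _} f := ⟨ObjectProperty.homMk (monadHomOfClone S.property f),
    monadClone_map_monadHomOfClone S.property f⟩

/-! ### The term monad of a clone -/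

namespace Clone

variable (C : Clone.{u})

theorem monad_map_mk {X Y : Type u} (f : X → Y) {n : ℕ} (θ : C.Op n) (x : Fin n → X) :
    C.monad.map (↾f) (Term.mk θ x) = Term.mk θ (fun i => f (x i)) := by
  refine (Term.eval_mk (Term.algebra C Y) (fun x => Term.ofVar (f x)) θ x).trans ?_
  exact (Term.mk_eq_op _ _).symm

theorem extend_monad_mk {X Y : Type u} (f : X → Term C Y) {n : ℕ} (θ : C.Op n) (x : Fin n → X) :
    extend C.monad f (Term.mk θ x) = (Term.algebra C Y).op θ (fun i => f (x i)) := by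
  refine (congrArg (C.monad.μ.app Y) (monad_map_mk C f θ x)).trans ?_
  exact Term.eval_mk (Term.algebra C Y) id θ _

theorem isFinitary_monad : isFinitary C.monad := by
  refine preservesFilteredColimits_of_exists_map_eq C.monad.toFunctor fun {X} t => ?_
  obtain ⟨n, θ, x, rfl⟩ := Term.exists_mk (C := C) (X := X) t
  exact ⟨n, x, Term.mk θ ULift.up, monad_map_mk C _ θ ULift.up⟩

/-- The clone of the monad of terms of a clone. -/
noncomputable def monadCloneMonadIso : monadClone.obj C.monad ≅ C :=
  (isoOfEquiv (C := C) (D := monadClone.obj C.monad)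
    (fun n =>
      { toFun := fun θ => (Term.mk θ ULift.up : Term C (ULift (Fin n)))
        -- A term in `n` variables is recovered from its value at the tautological renaming.
        invFun := fun t => (show Term C (ULift (Fin n)) from t).1 n ULift.down
        left_inv := fun θ => C.subst_var θ
        right_inv := fun t => by
          obtain ⟨m, θ, x, rfl⟩ := Term.exists_mk (C := C) (X := ULift (Fin n)) t
          exact Term.mk_rename _ _ _ })
    (fun i => Term.mk_var i _)
    (fun {m n} θ σ => by
      refine Eq.trans ?_ (extend_monad_mk C
        (fun s : ULift (Fin m) => Term.mk (σ s.down) ULift.up) θ ULift.up).symm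
      exact (Term.op_mk θ σ ULift.up).symm)).symm

end Clone

instance : finitaryMonadClone.{u}.EssSurj where
  mem_essImage C := ⟨⟨C.monad, C.isFinitary_monad⟩, ⟨C.monadCloneMonadIso⟩⟩

/-! ### The clone of a Lawvere theory -/

namespace LawvereTheory

section

variable (L : LawvereTheory.{u})

/-- The morphism into a power with given components. -/
noncomputable def lift {Z : L.Obj} {n : ℕ} (σ : Fin n → (Z ⟶ L.pow 1)) : Z ⟶ L.pow n :=
  Fan.IsLimit.lift (L.isPower n).some σ

@[simp]
theorem lift_π {Z : L.Obj} {n : ℕ} (σ : Fin n → (Z ⟶ L.pow 1)) (i : Fin n) :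
    L.lift σ ≫ L.π n i = σ i :=
  Fan.IsLimit.fac (L.isPower n).some σ i

theorem hom_ext {Z : L.Obj} {n : ℕ} {f g : Z ⟶ L.pow n}
    (h : ∀ i, f ≫ L.π n i = g ≫ L.π n i) : f = g :=
  Fan.IsLimit.hom_ext (L.isPower n).some _ _ h

theorem comp_lift {Y Z : L.Obj} {n : ℕ} (f : Y ⟶ Z) (σ : Fin n → (Z ⟶ L.pow 1)) :
    f ≫ L.lift σ = L.lift (fun i => f ≫ σ i) :=
  L.hom_ext fun i => by simp

theorem lift_comp_π {Z : L.Obj} {n : ℕ} (f : Z ⟶ L.pow n) : L.lift (fun i => f ≫ L.π n i) = f :=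
  L.hom_ext fun i => by simp

theorem lift_fin_one {Z : L.Obj} (σ : Fin 1 → (Z ⟶ L.pow 1)) : L.lift σ = σ 0 := by
  rw [← L.lift_π σ 0, L.π_one, Category.comp_id]

/-- The clone of a Lawvere theory, with `n`-ary operations the morphisms `X ^ n ⟶ X`. -/
noncomputable def clone : Clone.{u} where
  Op n := L.pow n ⟶ L.pow 1
  var i := L.π _ i
  subst θ σ := L.lift σ ≫ θ
  var_subst i σ := L.lift_π σ i
  subst_var θ := by
    rw [show L.lift (L.π _) = 𝟙 _ from L.hom_ext fun i => by simp, Category.id_comp]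
  subst_subst θ σ τ := by rw [← Category.assoc, L.comp_lift]

end

/-! ### Morphisms of theories on powers -/

namespace Hom

variable {L L' : LawvereTheory.{u}} (F : Hom L L')

/-- The action of a morphism of Lawvere theories on morphisms between powers. -/
def mapPow {m n : ℕ} (f : L.pow m ⟶ L.pow n) : L'.pow m ⟶ L'.pow n :=
  eqToHom (F.obj_pow m).symm ≫ F.toFunctor.map f ≫ eqToHom (F.obj_pow n)

theorem map_eq_mapPow {m n : ℕ} (f : L.pow m ⟶ L.pow n) : F.toFunctor.map f =
    eqToHom (F.obj_pow m) ≫ F.mapPow f ≫ eqToHom (F.obj_pow n).symm := by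
  simp [mapPow]

theorem mapPow_comp {l m n : ℕ} (f : L.pow l ⟶ L.pow m) (g : L.pow m ⟶ L.pow n) :
    F.mapPow (f ≫ g) = F.mapPow f ≫ F.mapPow g := by
  simp [mapPow]

theorem mapPow_π (n : ℕ) (i : Fin n) : F.mapPow (L.π n i) = L'.π n i := by
  simp [mapPow, F.map_π]

theorem mapPow_lift {m n : ℕ} (σ : Fin n → (L.pow m ⟶ L.pow 1)) :
    F.mapPow (L.lift σ) = L'.lift (fun i => F.mapPow (σ i)) :=
  L'.hom_ext fun i => by rw [lift_π, ← F.mapPow_π n i, ← F.mapPow_comp, lift_π]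

theorem mapPow_id {L : LawvereTheory.{u}} {m n : ℕ} (f : L.pow m ⟶ L.pow n) :
    Hom.mapPow (𝟙 L) f = f :=
  (Category.id_comp _).trans (Category.comp_id _)

theorem mapPow_comp_hom {L'' : LawvereTheory.{u}} (F : L ⟶ L') (G : L' ⟶ L'') {m n : ℕ}
    (f : L.pow m ⟶ L.pow n) : Hom.mapPow (F ≫ G) f = Hom.mapPow G (Hom.mapPow F f) := by
  change eqToHom _ ≫ (Hom.toFunctor G).map ((Hom.toFunctor F).map f) ≫ eqToHom _ = _
  simp [mapPow, eqToHom_map]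

/-- A morphism into a power is determined by its composites with the projections, which both
functors preserve, so agreement on operations suffices. -/
theorem ext_mapPow {F G : L ⟶ L'}
    (h : ∀ (n : ℕ) (θ : L.pow n ⟶ L.pow 1), Hom.mapPow F θ = Hom.mapPow G θ) : F = G := by
  have h' (m n : ℕ) (f : L.pow m ⟶ L.pow n) : Hom.mapPow F f = Hom.mapPow G f :=
    L'.hom_ext fun i => by
      rw [← Hom.mapPow_π F n i, ← Hom.mapPow_comp, h, Hom.mapPow_comp, Hom.mapPow_π, Hom.mapPow_π]
  refine Hom.ext (CategoryTheory.Functor.ext (fun X => ?_) fun X Y f => ?_)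
  · obtain ⟨n, rfl⟩ := L.pow_bijective.2 X
    exact (Hom.obj_pow F n).trans (Hom.obj_pow G n).symm
  · obtain ⟨m, rfl⟩ := L.pow_bijective.2 X
    obtain ⟨n, rfl⟩ := L.pow_bijective.2 Y
    rw [Hom.map_eq_mapPow F, Hom.map_eq_mapPow G, h']
    simp

end Hom

/-- The functor sending a Lawvere theory to its clone. -/
noncomputable def toClone : LawvereTheory.{u} ⥤ Clone.{u} where
  obj L := L.clone
  map {L L'} F :=
    { toFun := fun {n} θ => Hom.mapPow (L := L) (L' := L') F (m := n) (n := 1) θ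
      map_var := fun i => Hom.mapPow_π F _ i
      map_subst := fun {m n} θ σ =>
        (Hom.mapPow_comp F (L.lift (Z := L.pow n) (n := m) σ) θ).trans
          (congrArg (· ≫ _) (Hom.mapPow_lift F (m := n) (n := m) σ)) }
  map_id L := Clone.hom_ext fun n θ => Hom.mapPow_id (L := L) (m := n) (n := 1) θ
  map_comp F G := Clone.hom_ext fun n θ =>
    Hom.mapPow_comp_hom F G (m := n) (n := 1) θ

instance : toClone.{u}.Faithful where
  map_injective {L L' _ _} h := Hom.ext_mapPow fun n θ =>
    congrArg (fun f : toClone.obj L ⟶ toClone.obj L' => Clone.Hom.toFun f (n := n) θ) h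

/-! ### Morphisms of theories from clone morphisms -/

section

variable {L L' : LawvereTheory.{u}} (φ : Clone.Hom L.clone L'.clone)

/-- The action of a morphism of clones on morphisms from a power to the distinguished object. -/
def cloneApp {n : ℕ} (θ : L.pow n ⟶ L.pow 1) : L'.pow n ⟶ L'.pow 1 := φ.toFun (n := n) θ

theorem cloneApp_π {n : ℕ} (i : Fin n) : cloneApp φ (L.π n i) = L'.π n i := φ.map_var i

theorem cloneApp_lift_comp {m n : ℕ} (σ : Fin m → (L.pow n ⟶ L.pow 1)) (θ : L.pow m ⟶ L.pow 1) :
    cloneApp φ (L.lift σ ≫ θ) = L'.lift (fun i => cloneApp φ (σ i)) ≫ cloneApp φ θ :=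
  φ.map_subst (m := m) (n := n) θ σ

/-- The action of a morphism of clones on morphisms between powers. -/
noncomputable def cloneMap {m n : ℕ} (f : L.pow m ⟶ L.pow n) : L'.pow m ⟶ L'.pow n :=
  L'.lift (fun i => cloneApp φ (f ≫ L.π n i))

theorem cloneMap_id (n : ℕ) : cloneMap φ (𝟙 (L.pow n)) = 𝟙 (L'.pow n) :=
  L'.hom_ext fun i => by
    rw [cloneMap, lift_π, Category.id_comp, Category.id_comp, cloneApp_π]

/-- Writing `f` as the lift of its components turns composition into substitution. -/
theorem cloneMap_comp {l m n : ℕ} (f : L.pow l ⟶ L.pow m) (g : L.pow m ⟶ L.pow n) :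
    cloneMap φ (f ≫ g) = cloneMap φ f ≫ cloneMap φ g :=
  L'.hom_ext fun i => by
    rw [Category.assoc, cloneMap, lift_π, cloneMap, cloneMap, lift_π, ← cloneApp_lift_comp,
      L.lift_comp_π, Category.assoc]

theorem cloneMap_fin_one {n : ℕ} (θ : L.pow n ⟶ L.pow 1) : cloneMap φ θ = cloneApp φ θ := by
  rw [cloneMap, lift_fin_one, L.π_one, Category.comp_id]

/-- The exponent of `L.pow n` equals `n` only propositionally; phrasing the casts through equalities
of exponents lets them be eliminated in both theories at once. -/
theorem cloneMap_eqToHom {m m' n n' : ℕ} (hm : m' = m) (hn : n' = n) (f : L.pow m ⟶ L.pow n) :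
    cloneMap φ (eqToHom (congrArg L.pow hm) ≫ f ≫ eqToHom (congrArg L.pow hn.symm)) =
      eqToHom (congrArg L'.pow hm) ≫ cloneMap φ f ≫ eqToHom (congrArg L'.pow hn.symm) := by
  subst hm hn
  simp

/-- The exponent of an object of a Lawvere theory. -/
noncomputable def exponent (X : L.Obj) : ℕ := (L.pow_bijective.2 X).choose

theorem pow_exponent (X : L.Obj) : L.pow (exponent X) = X := (L.pow_bijective.2 X).choose_spec

theorem exponent_pow (n : ℕ) : exponent (L.pow n) = n := L.pow_bijective.1 (pow_exponent _)

/-- The morphism of Lawvere theories induced by a morphism of clones. -/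
noncomputable def homOfClone : L ⟶ L' where
  toFunctor :=
    { obj := fun X => L'.pow (exponent X)
      map := fun {X Y} f => cloneMap φ
        (eqToHom (pow_exponent X) ≫ f ≫ eqToHom (pow_exponent Y).symm)
      map_id := fun X => by simp [cloneMap_id]
      map_comp := fun f g => by rw [← cloneMap_comp]; simp }
  obj_pow n := congrArg L'.pow (exponent_pow n)
  map_π n i := by
    refine (cloneMap_eqToHom φ (exponent_pow n) (exponent_pow 1) (L.π n i)).trans ?_
    rw [cloneMap_fin_one, cloneApp_π]

theorem mapPow_homOfClone {m n : ℕ} (f : L.pow m ⟶ L.pow n) :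
    Hom.mapPow (homOfClone φ) f = cloneMap φ f := by
  have h := cloneMap_eqToHom φ (exponent_pow (L := L) m) (exponent_pow (L := L) n) f
  refine (congrArg (fun f => eqToHom _ ≫ f ≫ eqToHom _) h).trans ?_
  have cancel : ∀ {X Y X' Y' : L'.Obj} (hX : X' = X) (hY : Y = Y') (g : X ⟶ Y),
      eqToHom hX.symm ≫ (eqToHom hX ≫ g ≫ eqToHom hY) ≫ eqToHom hY.symm = g := by
    intros
    simp
  exact cancel _ _ _

end

instance : toClone.{u}.Full where
  map_surjective φ := ⟨homOfClone φ, Clone.hom_ext fun n θ =>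
    (mapPow_homOfClone φ (m := n) (n := 1) θ).trans (cloneMap_fin_one φ θ)⟩

/-! ### Models as algebras for the clone of a Lawvere theory -/

namespace Model

variable {L : LawvereTheory.{u}} (M : L.Model)

theorem tuple_bijective (n : ℕ) : Function.Bijective
    (fun (a : M.obj.obj (L.pow n)) (i : Fin n) => M.obj.map (L.π n i) a) := by
  have : PreservesFiniteProducts M.obj := M.property
  obtain ⟨h⟩ := L.isPower n
  -- Elements are handled as maps out of the one-point set.
  have h' := (fan_isLimit_iff _ _).1
    ⟨Fan.isLimitMapConeEquiv M.obj _ _ (isLimitOfPreserves M.obj h)⟩ PUnit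
  refine ⟨fun a b e => ?_, fun x => ?_⟩
  · refine ConcreteCategory.congr_hom (h'.1 (a₁ := ↾fun _ => a) (a₂ := ↾fun _ => b)
      (funext fun i => ConcreteCategory.hom_ext _ _ fun _ => congrFun e i)) PUnit.unit
  · obtain ⟨g, hg⟩ := h'.2 (fun i => ↾fun _ => x i)
    exact ⟨g PUnit.unit, funext fun i => ConcreteCategory.congr_hom (congrFun hg i) PUnit.unit⟩

/-- The element of a power with given components. -/
noncomputable def tuple {n : ℕ} (x : Fin n → M.obj.obj (L.pow 1)) : M.obj.obj (L.pow n) :=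
  ((M.tuple_bijective n).2 x).choose

theorem map_π_tuple {n : ℕ} (x : Fin n → M.obj.obj (L.pow 1)) (i : Fin n) :
    M.obj.map (L.π n i) (M.tuple x) = x i :=
  congrFun ((M.tuple_bijective n).2 x).choose_spec i

theorem tuple_eq_iff {n : ℕ} (x : Fin n → M.obj.obj (L.pow 1)) (a : M.obj.obj (L.pow n)) :
    M.tuple x = a ↔ ∀ i, x i = M.obj.map (L.π n i) a := by
  refine ⟨fun h i => by rw [← h, map_π_tuple], fun h => (M.tuple_bijective n).1 ?_⟩
  exact funext fun i => (M.map_π_tuple x i).trans (h i)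

theorem map_map_apply {X Y Z : L.Obj} (f : X ⟶ Y) (g : Y ⟶ Z) (a : M.obj.obj X) :
    M.obj.map g (M.obj.map f a) = M.obj.map (f ≫ g) a :=
  (ConcreteCategory.congr_hom (M.obj.map_comp f g) a).symm

theorem naturality_apply {M N : L.Model} (α : M ⟶ N) {X Y : L.Obj} (f : X ⟶ Y)
    (a : M.obj.obj X) : α.hom.app Y (M.obj.map f a) = N.obj.map f (α.hom.app X a) :=
  ConcreteCategory.congr_hom (α.hom.naturality f) a

theorem eq_of_map_eq {X : L.Obj} {a b : M.obj.obj X}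
    (h : ∀ p : X ⟶ L.pow 1, M.obj.map p a = M.obj.map p b) : a = b := by
  obtain ⟨n, rfl⟩ := L.pow_bijective.2 X
  exact (M.tuple_bijective n).1 (funext fun i => h _)

/-- A model of a Lawvere theory as an algebra for its clone. -/
noncomputable def toAlgebra (L : LawvereTheory.{u}) : L.Model ⥤ (toClone.obj L).Algebra where
  obj M :=
    { carrier := M.obj.obj (L.pow 1)
      op := fun {n} θ x => M.obj.map (X := L.pow n) (Y := L.pow 1) θ (M.tuple x)
      op_var := fun i x => M.map_π_tuple x i
      op_subst := fun {m n} θ σ x => by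
        refine (M.map_map_apply (L.lift (Z := L.pow n) (n := m) σ) θ _).symm.trans
          (congrArg _ ((M.tuple_eq_iff _ _).2 fun i => ?_).symm)
        rw [map_map_apply]
        exact congrArg (fun f => M.obj.map f (M.tuple x))
          (L.lift_π (Z := L.pow n) (n := m) σ i).symm }
  map {M N} α :=
    { toFun := fun a => α.hom.app (L.pow 1) a
      map_op := fun {n} θ x => by
        refine (naturality_apply α (X := L.pow n) (Y := L.pow 1) θ (M.tuple x)).trans
          (congrArg _ ((N.tuple_eq_iff _ _).2 fun i => ?_).symm)
        rw [← naturality_apply, map_π_tuple] }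

instance (L : LawvereTheory.{u}) : (toAlgebra L).Faithful where
  map_injective {M N α β} h := ObjectProperty.hom_ext _ (NatTrans.ext (funext fun X =>
    ConcreteCategory.hom_ext _ _ fun a => N.eq_of_map_eq fun p => by
      rw [← naturality_apply, ← naturality_apply]
      exact congrFun (congrArg (Clone.Algebra.Hom.toFun (A := (toAlgebra L).obj M)
        (B := (toAlgebra L).obj N)) h) (M.obj.map p a)))

/-- At `X ^ n` the extension acts componentwise, and each `p` is an `n`-ary operation respected by
`h`. Characterising `b` by all `p`, not only the projections, makes it unique and its naturality
automatic. -/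
theorem exists_extension {M N : L.Model}
    (h : Clone.Algebra.Hom ((toAlgebra L).obj M) ((toAlgebra L).obj N)) (X : L.Obj)
    (a : M.obj.obj X) :
    ∃ b : N.obj.obj X, ∀ p : X ⟶ L.pow 1, N.obj.map p b = h.toFun (M.obj.map p a) := by
  obtain ⟨n, rfl⟩ := L.pow_bijective.2 X
  refine ⟨N.tuple fun i => h.toFun (M.obj.map (L.π n i) a), fun p => ?_⟩
  refine (h.map_op (n := n) p _).symm.trans (congrArg h.toFun (congrArg (M.obj.map p) ?_))
  exact (M.tuple_eq_iff _ a).2 fun i => rfl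

instance (L : LawvereTheory.{u}) : (toAlgebra L).Full where
  map_surjective {M N} h := by
    choose b hb using exists_extension h
    refine ⟨ObjectProperty.homMk
      { app := fun X => ↾(b X)
        naturality := fun X Y f => ConcreteCategory.hom_ext _ _ fun a =>
          N.eq_of_map_eq fun p => ?_ }, Clone.Algebra.hom_ext fun a => ?_⟩
    · refine (hb Y (M.obj.map f a) p).trans (Eq.trans ?_ (N.map_map_apply f p (b X a)).symm)
      rw [hb, map_map_apply]
    · have e := hb (L.pow 1) a (𝟙 _)
      rw [M.obj.map_id, N.obj.map_id] at e
      exact e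

end Model

end LawvereTheory

/-! ### The Lawvere theory of a monad and its clone -/

section

variable {T : Monad (Type u)}

theorem map_extend {X Y Z : Type u} (f : X → T.obj Y) (g : Y → Z) (t : T.obj X) :
    T.map (↾g) (extend T f t) = extend T (fun x => T.map (↾g) (f x)) t := by
  simp only [map_eq_extend, extend_extend]

theorem extend_map {X Y Z : Type u} (f : X → Y) (g : Y → T.obj Z) (t : T.obj X) :
    extend T g (T.map (↾f) t) = extend T (fun x => g (f x)) t := by
  simp only [map_eq_extend, extend_extend, extend_η]

/-- The components of a morphism of the Lawvere theory of `T`, as elements of `T n`. -/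
def component {X Y : (theory T).Obj} (f : X ⟶ Y) (i : Fin Y.obj.exp) :
    T.obj (ULift (Fin X.obj.exp)) :=
  T.map (↾fun s : ULift (Fin (X.obj.exp * 1)) => ULift.up (finProdFinEquiv.symm s.down).1) (f i)

/-- The morphism of the Lawvere theory of `T` with given components. -/
def ofComponents {X Y : (theory T).Obj} (θ : Fin Y.obj.exp → T.obj (ULift (Fin X.obj.exp))) :
    X ⟶ Y :=
  fun i => T.map (↾fun s : ULift (Fin X.obj.exp) =>
    ULift.up (finProdFinEquiv (s.down, (0 : Fin 1)))) (θ i)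

theorem component_ofComponents {X Y : (theory T).Obj}
    (θ : Fin Y.obj.exp → T.obj (ULift (Fin X.obj.exp))) (i : Fin Y.obj.exp) :
    component (ofComponents (X := X) (Y := Y) θ) i = θ i := by
  refine (map_map_apply T.toFunctor _ _ _).trans ?_
  simp only [Equiv.symm_apply_apply]
  exact ConcreteCategory.congr_hom (T.map_id _) (θ i)

theorem ofComponents_component {X Y : (theory T).Obj} (f : X ⟶ Y) :
    ofComponents (component f) = f := by
  funext i
  refine (map_map_apply T.toFunctor _ _ _).trans ?_
  have h : ∀ s : Fin (X.obj.exp * 1),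
      finProdFinEquiv ((finProdFinEquiv.symm s).1, (0 : Fin 1)) = s := fun s => by
    rw [← Subsingleton.elim (finProdFinEquiv.symm s).2 0, Prod.mk.eta, Equiv.apply_symm_apply]
  simp only [h]
  exact ConcreteCategory.congr_hom (T.map_id _) (f i)

/-- Once `n * 1` is identified with `n`, composition in `L(ΣT)` is Kleisli substitution. -/
theorem component_comp {X Y Z : (theory T).Obj} (f : X ⟶ Y) (g : Y ⟶ Z) (i : Fin Z.obj.exp) :
    component (f ≫ g) i = extend T (fun s => component f s.down) (component g i) := by
  exact (map_extend _ _ _).trans (extend_map _ (fun s : ULift (Fin Y.obj.exp) => component f s.down) (g i)).symm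

theorem component_reindex_one {X : (theory T).Obj} (i : Fin X.obj.exp) :
    T.map (↾fun s : ULift (Fin (X.obj.exp * 1)) => ULift.up (finProdFinEquiv.symm s.down).1)
      ((suspension T).proj PUnit.unit (finProdFinEquiv (i, (0 : Fin 1)))) =
      T.η.app (ULift (Fin X.obj.exp)) ⟨i⟩ := by
  refine (map_map_apply T.toFunctor _ _ _).trans ?_
  simp only [Equiv.symm_apply_apply]
  exact map_η_apply (T := T) (X := ULift (Fin X.obj.exp)) ⟨i⟩

theorem component_id (X : (theory T).Obj) (i : Fin X.obj.exp) :
    component (𝟙 X) i = T.η.app (ULift (Fin X.obj.exp)) ⟨i⟩ :=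
  component_reindex_one i

theorem component_π (n : ℕ) (i : Fin n) (j : Fin 1) :
    component ((theory T).π n i) j = T.η.app (ULift (Fin n)) ⟨i⟩ :=
  component_reindex_one (X := (theory T).pow n) i

theorem component_eq_comp_π {X : (theory T).Obj} {n : ℕ} (f : X ⟶ (theory T).pow n)
    (i : Fin n) (j : Fin 1) :
    component (Y := (theory T).pow 1) (f ≫ (theory T).π n i) j =
      component (Y := (theory T).pow n) f i := by
  refine (component_comp (Y := (theory T).pow n) (Z := (theory T).pow 1) f _ j).trans ?_
  exact (congrArg _ (component_π n i j)).trans (extend_η T _ _)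

theorem component_lift {X : (theory T).Obj} {n : ℕ} (σ : Fin n → (X ⟶ (theory T).pow 1))
    (i : Fin n) : component (Y := (theory T).pow n) ((theory T).lift σ) i =
      component (Y := (theory T).pow 1) (σ i) (0 : Fin 1) := by
  rw [← component_eq_comp_π _ i 0, LawvereTheory.lift_π]

variable (T) in
/-- The clone of the Lawvere theory of a monad is the clone of the monad. -/
noncomputable def cloneTheoryIso : LawvereTheory.toClone.obj (theory T) ≅ monadClone.obj T :=
  Clone.isoOfEquiv
    (fun n =>
      { toFun := fun f => component (X := (theory T).pow n) (Y := (theory T).pow 1) f (0 : Fin 1)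
        invFun := fun θ => ofComponents (X := (theory T).pow n) (Y := (theory T).pow 1) fun _ => θ
        left_inv := fun f => by
          refine Eq.trans (congrArg _ (funext fun i => ?_))
            (ofComponents_component (X := (theory T).pow n) (Y := (theory T).pow 1) f)
          exact congrArg _ (Subsingleton.elim (α := Fin 1) _ _)
        right_inv := fun θ => component_ofComponents (X := (theory T).pow n)
          (Y := (theory T).pow 1) (fun _ => θ) _ })
    (fun i => component_π _ i (0 : Fin 1))
    (fun {m n} θ σ => by
      refine (component_comp ((theory T).lift (Z := (theory T).pow n) (n := m) σ) θ _).trans ?_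
      exact congrArg (fun f => extend T f _) (funext fun s =>
        component_lift (X := (theory T).pow n) (n := m) σ s.down))

theorem component_map {S : Monad (Type u)} (α : S ⟶ T) {X Y : (theory S).Obj} (f : X ⟶ Y)
    (i : Fin Y.obj.exp) :
    component ((suspensionMap α).completion.underlying.map f) i =
      α.app (ULift (Fin X.obj.exp)) (component f i) :=
  (ConcreteCategory.congr_hom (α.naturality _) (f i)).symm

end

/-- The clone of the Lawvere theory of a finitary monad is naturally the clone of the monad. -/
noncomputable def theoryFunctorCompToCloneIso :
    theoryFunctor.{u} ⋙ LawvereTheory.toClone ≅ finitaryMonadClone :=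
  NatIso.ofComponents (fun T => cloneTheoryIso T.obj) fun {S T} α => Clone.hom_ext fun n θ => by
    refine Eq.trans ?_ (component_map α.hom (X := (theory S.obj).pow n)
      (Y := (theory S.obj).pow 1) θ (0 : Fin 1))
    exact congrArg (fun f => component (X := (theory T.obj).pow n) (Y := (theory T.obj).pow 1) f
      (0 : Fin 1)) ((Category.id_comp _).trans (Category.comp_id _))

instance : theoryFunctor.{u}.Faithful :=
  have := Functor.Faithful.of_iso theoryFunctorCompToCloneIso.{u}.symm
  Functor.Faithful.of_comp theoryFunctor LawvereTheory.toClone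

instance : theoryFunctor.{u}.Full :=
  have := Functor.Full.of_iso theoryFunctorCompToCloneIso.{u}.symm
  Functor.Full.of_comp_faithful theoryFunctor LawvereTheory.toClone

/-- A monad with the same clone as `L` exists; full faithfulness of `toClone` lifts the isomorphism
of clones to one of theories. -/
instance : theoryFunctor.{u}.EssSurj where
  mem_essImage L := ⟨finitaryMonadClone.objPreimage (LawvereTheory.toClone.obj L),
    ⟨LawvereTheory.toClone.preimageIso (theoryFunctorCompToCloneIso.app _ ≪≫
      finitaryMonadClone.objObjPreimageIso _)⟩⟩

instance : theoryFunctor.{u}.IsEquivalence where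

/-! ### Algebras for a monad as models of its Lawvere theory -/

section

variable (T : Monad (Type u))

/-- The functor `X ^ n ↦ A ^ n` on the Lawvere theory of a monad, for an algebra `A`. -/
def algebraPowers (A : T.Algebra) : (theory T).Obj ⥤ Type u where
  obj X := Fin X.obj.exp → A.A
  map {X Y} f := ↾fun x i => A.a (T.map (↾fun s : ULift (Fin X.obj.exp) => x s.down)
    (component f i))
  map_id X := ConcreteCategory.hom_ext _ _ fun x => funext fun i => by
    refine (congrArg (fun t => A.a (T.map _ t)) (component_id X i)).trans ?_
    exact ((algebraToClone T).obj A).op_var i x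
  map_comp f g := ConcreteCategory.hom_ext _ _ fun x => funext fun i => by
    refine (congrArg (fun t => A.a (T.map _ t)) (component_comp f g i)).trans ?_
    exact algebra_map_extend T A _ _ _

theorem algebraPowers_map_π (A : T.Algebra) {n : ℕ} (x : Fin n → A.A) (i : Fin n) :
    (algebraPowers T A).map ((theory T).π n i) x = fun _ => x i := by
  funext j
  refine (congrArg (fun t => A.a (T.map _ t)) (component_π n i j)).trans ?_
  exact ((algebraToClone T).obj A).op_var i x

/-- The projections act as the coordinates of `A ^ n`, up to the identification of `A` with `Fin 1 →
A`. -/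
theorem isModel_algebraPowers (A : T.Algebra) : (theory T).isModel (algebraPowers T A) := by
  refine preservesFiniteProducts_of_powers (theory T).π _ (theory T).pow_bijective.2
    (theory T).isPower fun n => (fan_isLimit_iff _ _).2 fun Z => ⟨fun g g' e => ?_, fun k => ?_⟩
  · refine ConcreteCategory.hom_ext _ _ fun z => funext fun i => ?_
    have h := ConcreteCategory.congr_hom (congrFun e i) z
    exact congrFun ((algebraPowers_map_π T A (g z) i).symm.trans
      (h.trans (algebraPowers_map_π T A (g' z) i))) (0 : Fin 1)
  · refine ⟨↾fun z i => k i z (0 : Fin 1), funext fun i => ConcreteCategory.hom_ext _ _ fun z => ?_⟩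
    refine (algebraPowers_map_π T A _ i).trans (funext fun j => ?_)
    exact congrArg (k i z) (Subsingleton.elim (α := Fin 1) _ _)

/-- The comparison functor from algebras for a monad to models of its Lawvere theory. -/
def algebraToModel : T.Algebra ⥤ (theory T).Model where
  obj A := ⟨algebraPowers T A, isModel_algebraPowers T A⟩
  map {A B} f := ObjectProperty.homMk
    { app := fun X => ↾fun x i => f.f (x i)
      naturality := fun X Y g => ConcreteCategory.hom_ext _ _ fun x => funext fun i =>
        (Clone.Algebra.Hom.map_op ((algebraToClone T).map f) (n := X.obj.exp)
          (component g i) x) }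

/-- The comparison functor is compatible with the passage to algebras for the clone. -/
noncomputable def algebraToModelCompIso :
    algebraToModel T ⋙ LawvereTheory.Model.toAlgebra (theory T) ≅
      algebraToClone T ⋙ Clone.Algebra.restrict (cloneTheoryIso T).hom :=
  NatIso.ofComponents (fun A => Clone.Algebra.isoOfEquiv
      { toFun := fun x : Fin 1 → A.A => x 0
        invFun := fun a (_ : Fin 1) => a
        left_inv := fun (x : Fin 1 → A.A) => funext fun i => congrArg x (Subsingleton.elim _ _)
        right_inv := fun _ => rfl }
    fun {n} θ (x : Fin n → Fin 1 → A.A) => by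
      -- The chosen tuple is opaque, but the projections determine it.
      have h : (LawvereTheory.Model.tuple ((algebraToModel T).obj A) x : Fin n → A.A) =
          fun i => x i 0 := funext fun i =>
        congrFun ((algebraPowers_map_π T A _ i).symm.trans
          (LawvereTheory.Model.map_π_tuple ((algebraToModel T).obj A) x i)) (0 : Fin 1)
      exact congrArg (fun y : Fin n → A.A => A.a (T.map (↾fun s : ULift (Fin n) => y s.down)
        (component (X := (theory T).pow n) (Y := (theory T).pow 1) θ (0 : Fin 1)))) h)
    fun f => rfl

/-- Its composite with the fully faithful `toAlgebra` is an equivalence, hence so is the functor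
itself. -/
theorem algebraToModel_isEquivalence (hT : isFinitary T) : (algebraToModel T).IsEquivalence := by
  have := algebraToClone_isEquivalence hT
  have := Functor.isEquivalence_of_iso (algebraToModelCompIso T).symm
  exact
    { faithful := Functor.Faithful.of_comp _ (LawvereTheory.Model.toAlgebra (theory T))
      full := Functor.Full.of_comp_faithful _ (LawvereTheory.Model.toAlgebra (theory T))
      essSurj := Functor.essSurj_of_comp_fully_faithful _
        (LawvereTheory.Model.toAlgebra (theory T)) }

end

/-! ### Pseudonaturality of the comparison -/

section

variable {S T : Monad (Type u)} (α : S ⟶ T)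

/-- The comparison functors are natural in the monad, at a given algebra. -/
def algebraPowersRestrictIso (A : T.Algebra) :
    algebraPowers S ((Monad.algebraFunctorOfMonadHom α).obj A) ≅
      (suspensionMap α).completion.underlying ⋙ algebraPowers T A :=
  NatIso.ofComponents (fun X => Iso.refl (Fin X.obj.exp → A.A)) fun {X Y} f =>
    ConcreteCategory.hom_ext _ _ fun (x : Fin X.obj.exp → A.A) => funext fun i => by
      refine (congrArg A.a (ConcreteCategory.congr_hom (α.naturality
        (↾fun s : ULift (Fin X.obj.exp) => x s.down)) (component f i))).trans ?_
      exact congrArg (fun t => A.a (T.map (↾fun s : ULift (Fin X.obj.exp) => x s.down) t))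
        (component_map α f i).symm

end

/-- The comparison functors are natural in the monad. -/
def algebraToModelRestrictIso {S T : FinitaryMonad.{u}} (α : S ⟶ T) :
    Monad.algebraFunctorOfMonadHom α.hom ⋙ algebraToModel S.obj ≅
      algebraToModel T.obj ⋙ LawvereTheory.Model.restrict (theoryFunctor.map α) :=
  NatIso.ofComponents (fun A => ObjectProperty.isoMk _ (algebraPowersRestrictIso α.hom A))
    fun _ => rfl

/-- The pseudonatural transformation from algebras for a finitary monad to models of its Lawvere
theory. -/
def algebrasToModels : Pseudofunctor.StrongTrans algebras.{u}.toPseudofunctor'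
    (theoryFunctor.{u}.op ⋙ LawvereTheory.models).toPseudofunctor' where
  app T := (algebraToModel T.as.unop.obj).toCatHom
  naturality f := Cat.Hom.isoMk (algebraToModelRestrictIso f.as.unop)
  naturality_naturality {a b f g} η := by
    -- The indexing bicategory is locally discrete, so its only 2-cells are identities.
    obtain rfl := LocallyDiscrete.eq_of_hom η
    have : η = 𝟙 f := Subsingleton.elim _ _
    subst this
    apply Cat.Hom₂.ext
    ext A
    apply ObjectProperty.hom_ext
    rfl
  naturality_id a := by
    apply Cat.Hom₂.ext
    ext A
    apply ObjectProperty.hom_ext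
    rfl
  naturality_comp f g := by
    apply Cat.Hom₂.ext
    ext A
    apply ObjectProperty.hom_ext
    rfl

end MonadTheory

theorem mainTheorem1 :
    ∃ e : MonadTheory.FinitaryMonad.{u} ≌ MonadTheory.LawvereTheory.{u},
      Nonempty (e.functor ≅ MonadTheory.theoryFunctor.{u}) ∧
      ∃ η : Pseudofunctor.StrongTrans
          (MonadTheory.algebras.{u}).toPseudofunctor'
          (e.functor.op ⋙ MonadTheory.LawvereTheory.models.{u}).toPseudofunctor',
        ∀ T, (η.app T).toFunctor.IsEquivalence :=
  ⟨MonadTheory.theoryFunctor.asEquivalence, ⟨Iso.refl _⟩, MonadTheory.algebrasToModels,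
    fun T => MonadTheory.algebraToModel_isEquivalence _ T.as.unop.property⟩
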